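/- Let $L>0$, $\mathbb{T}^3=(\mathbb{R}/L\mathbb{Z})^3$ and $0<T<\infty$. Let $b\in L^\infty(0,T;L^2(\mathbb{T}^3;\mathbb{R}^3))$ be a weak solution, with electric current $\vec j=\nabla\times b$, of the electron magnetohydrodynamic (EMHD) equations $$b_t+\nabla\times[(\nabla\times b)\times b]=0,\qquad \operatorname{div} b=0 .$$ That is, $\vec j$ is measurable on $(0,T)\times\mathbb{T}^3$; for a.e. $t$ one has $\vec j(t)\in L^1(\mathbb{T}^3)$, and $\nabla\times b(t)=\vec j(t)$ and $\operatorname{div}b(t)=0$ hold in the sense of distributions on $\mathbb{T}^3$; moreover $\vec j\times b\in L^1_{\rm loc}((0,T)\times\mathbb{T}^3)$ and $b_t+\nabla\times(\vec j\times b)=0$ in the sense of distributions on $(0,T)\times\mathbb{T}^3$. Let $1<r_1,r_2<\infty$ with $\frac{2}{r_1}+\frac{1}{r_2}=1$, and let $\alpha,\beta\in\mathbb{R}$ with $2\alpha+\beta\ge 1$. Let $C_1,C_2\ge 0$ be integrable functions on $(0,T)$, let $\rho>0$, and let $\sigma_1,\sigma_2$ be real functions on $\mathbb{R}^3$ that are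 non-negative and bounded on $\{|\ell|<\rho\}$. Assume that, for a.e. $t\in(0,T)$ and all $\ell\in\mathbb{R}^3$ with $|\ell|<\rho$, $$\Big(\int_{\mathbb{T}^3}|b(x+\ell,t)-b(x,t)|^{9/2}\,dx\Big)^{2/9}\le C_1(t)^{1/r_1}|\ell|^{\alpha}\sigma_1(\ell)^{1/3},$$ $$\Big(\int_{\mathbb{T}^3}|\vec j(x+\ell,t)-\vec j(x,t)|^{9/5}\,dx\Big)^{5/9}\le C_2(t)^{1/r_2}|\ell|^{\beta}\sigma_2(\ell)^{1/3}.$$ Suppose that at least one of $\sigma_1,\sigma_2$ satisfies $\sigma_i(\ell)\to0$ as $\ell\to0$. Then the dissipation term of the energy vanishes and the energy is conserved. Precisely, let $\varphi(y)=C_0e^{-1/(1-|y|^2)}$ for $|y|<1$ and $\varphi(y)=0$ for $|y|\ge1$, where $C_0$ is such that $\int_{\mathbb{R}^3}\varphi=1$, and put $\varphi_\varepsilon(y)=\varepsilon^{-3}\varphi(y/\varepsilon)$ and $\delta f(\ell)=f(x+\ell,t)-f(x,t)$. Then $$D(b,\vec j;\varepsilon)=\frac18\int_{\mathbb{R}^3}\nabla\varphi_\varepsilon(\ell)\cdot\delta\vec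 j(\ell)\,|\delta b(\ell)|^2\,d\ell-\frac14\int_{\mathbb{R}^3}\nabla\varphi_\varepsilon(\ell)\cdot\delta b(\ell)\,\big(\delta\vec j(\ell)\cdot\delta b(\ell)\big)\,d\ell$$ is integrable on $(0,T)\times\mathbb{T}^3$ for all sufficiently small $\varepsilon>0$ and tends to $0$ in $L^1((0,T)\times\mathbb{T}^3)$ as $\varepsilon\to0^+$ (so its distributional limit $D(b,\vec j)$ is $0$); and there is a constant $E$ such that $$\frac12\int_{\mathbb{T}^3}|b(x,t)|^2\,dx=E\qquad\text{for a.e. }t\in(0,T).$$ -/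

import Mathlib

open Set Filter Topology MeasureTheory
open scoped ContDiff

noncomputable section

namespace EMHD

/-- Three-dimensional Euclidean space. -/
abbrev E3 : Type := EuclideanSpace ℝ (Fin 3)

/-- The flat torus `(ℝ / Lℤ)³`. Its `volume` is the Lebesgue measure, of total mass `L ^ 3`. -/
abbrev Torus (L : ℝ) : Type := Fin 3 → AddCircle L

/-- The quotient map from `ℝ³` onto the torus. -/
def proj (L : ℝ) (y : E3) : Torus L := fun i => (y i : AddCircle L)

/-- The partial derivative `∂ᵢ f` of a function on the torus. -/
def pderiv {L : ℝ} (i : Fin 3) (f : Torus L → ℝ) (x : Torus L) : ℝ :=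
  deriv (fun s : ℝ => f (x + proj L (EuclideanSpace.single i s))) 0

/-- The classical curl `∇ × v` of a vector field on the torus. -/
def curl {L : ℝ} (v : Torus L → E3) (x : Torus L) : E3 :=
  !₂[pderiv 1 (fun y => v y 2) x - pderiv 2 (fun y => v y 1) x,
     pderiv 2 (fun y => v y 0) x - pderiv 0 (fun y => v y 2) x,
     pderiv 0 (fun y => v y 1) x - pderiv 1 (fun y => v y 0) x]

/-- The vector product in `ℝ³`. -/
def cross (u v : E3) : E3 :=
  !₂[u 1 * v 2 - u 2 * v 1, u 2 * v 0 - u 0 * v 2, u 0 * v 1 - u 1 * v 0]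

/-- Smooth functions on the torus: those whose periodic lift to `ℝ³` is smooth. -/
def IsSmooth {L : ℝ} {F : Type} [NormedAddCommGroup F] [NormedSpace ℝ F]
    (f : Torus L → F) : Prop :=
  ContDiff ℝ ∞ (fun y : E3 => f (proj L y))

/-- Vector-valued test functions on `(0,T) × 𝕋³`: smooth in `(t, x)`, and supported in
`[a, c] × 𝕋³` for some `0 < a`, `c < T`. -/
def IsTestField {L : ℝ} (T : ℝ) (Φ : ℝ → Torus L → E3) : Prop :=
  ContDiff ℝ ∞ (fun p : ℝ × E3 => Φ p.1 (proj L p.2)) ∧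
    ∃ a c : ℝ, 0 < a ∧ c < T ∧ ∀ t, t ∉ Icc a c → ∀ x, Φ t x = 0

/-- Lebesgue measure on `(0,T) × 𝕋³`. -/
def spaceTime (L T : ℝ) [Fact (0 < L)] : Measure (ℝ × Torus L) :=
  (volume.restrict (Ioo 0 T)).prod volume

/-- `div v = 0` in the sense of distributions on the torus. -/
def WeakDivFree {L : ℝ} [Fact (0 < L)] (v : Torus L → E3) : Prop :=
  ∀ ψ : Torus L → ℝ, IsSmooth ψ → ∫ x, ∑ i : Fin 3, v x i * pderiv i ψ x = 0

/-- `w = ∇ × v` in the sense of distributions on the torus. -/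
def IsWeakCurl {L : ℝ} [Fact (0 < L)] (v w : Torus L → E3) : Prop :=
  ∀ φ : Torus L → E3, IsSmooth φ → ∫ x, inner ℝ (w x) (φ x) = ∫ x, inner ℝ (v x) (curl φ x)

/-- `b ∈ L^∞(0,T; L²(𝕋³))`, with electric current `j = ∇ × b`, is a weak (distributional) solution
on `(0,T) × 𝕋³` of the EMHD equations `∂ₜ b + ∇ × [(∇ × b) × b] = 0`, `div b = 0`. -/
structure IsWeakSolution {L : ℝ} [Fact (0 < L)] (T : ℝ) (b j : ℝ → Torus L → E3) : Prop where
  measurable_b : AEStronglyMeasurable (fun p : ℝ × Torus L => b p.1 p.2) (spaceTime L T)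
  measurable_j : AEStronglyMeasurable (fun p : ℝ × Torus L => j p.1 p.2) (spaceTime L T)
  finite_energy : ∃ M : ℝ, ∀ᵐ t ∂(volume.restrict (Ioo 0 T)),
    MemLp (b t) 2 volume ∧ eLpNorm (b t) 2 volume ≤ ENNReal.ofReal M
  div_free : ∀ᵐ t ∂(volume.restrict (Ioo 0 T)), WeakDivFree (b t)
  current : ∀ᵐ t ∂(volume.restrict (Ioo 0 T)), Integrable (j t) volume ∧ IsWeakCurl (b t) (j t)
  /-- The nonlinear term is a distribution. -/
  integrable_nonlinearity : LocallyIntegrableOn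
    (fun p : ℝ × Torus L => cross (j p.1 p.2) (b p.1 p.2)) (Ioo 0 T ×ˢ univ)
  equation : ∀ Φ : ℝ → Torus L → E3, IsTestField T Φ →
    ∫ p, (inner ℝ (b p.1 p.2) (deriv (fun s => Φ s p.2) p.1)
      - inner ℝ (cross (j p.1 p.2) (b p.1 p.2)) (curl (Φ p.1) p.2)) ∂(spaceTime L T) = 0

/-- The increment `δf(ℓ) = f(x + ℓ) - f(x)`. -/
def incr {L : ℝ} (f : Torus L → E3) (ℓ : E3) (x : Torus L) : E3 := f (x + proj L ℓ) - f x

/-- The unnormalized standard bump function on `ℝ³`. -/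
def bump (y : E3) : ℝ := if ‖y‖ < 1 then Real.exp (-1 / (1 - ‖y‖ ^ 2)) else 0

/-- The rescaled standard mollifier `φ_ε(y) = ε⁻³ φ(y / ε)`, where `φ` has unit integral. -/
def mollifier (ε : ℝ) (y : E3) : ℝ := (ε ^ 3)⁻¹ * ((∫ z : E3, bump z)⁻¹ * bump (ε⁻¹ • y))

/-- The regularized dissipation term of the energy
`D(b,j;ε) = 1/8 ∫ ∇φ_ε(ℓ)·δj(ℓ) |δb(ℓ)|² dℓ - 1/4 ∫ ∇φ_ε(ℓ)·δb(ℓ) (δj(ℓ)·δb(ℓ)) dℓ`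
at time `t` and position `x`. -/
def dissipation {L : ℝ} (b j : ℝ → Torus L → E3) (ε t : ℝ) (x : Torus L) : ℝ :=
  (1 / 8) * (∫ ℓ : E3, inner ℝ (gradient (mollifier ε) ℓ) (incr (j t) ℓ x)
      * ‖incr (b t) ℓ x‖ ^ 2)
    - (1 / 4) * ∫ ℓ : E3, inner ℝ (gradient (mollifier ε) ℓ) (incr (b t) ℓ x)
      * inner ℝ (incr (j t) ℓ x) (incr (b t) ℓ x)

/-- The energy `½ ∫ |v|² dx`. -/
def energy {L : ℝ} [Fact (0 < L)] (v : Torus L → E3) : ℝ := (1 / 2) * ∫ x, ‖v x‖ ^ 2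

end EMHD

end

/-!
Mollify with a kernel `K` supported in an annulus `ε ≤ |ℓ| ≤ 4ε`, and write `f_ε` for the
mollification of `f`. Testing the equation against `b_ε` gives
`d/dt ½ ∫ |b_ε|² = -∫ j_ε · (j × b)_ε`. Since `j_ε · (j_ε × b_ε) = 0`, only the commutator
`(j × b)_ε - j_ε × b_ε` contributes. One factor `j_ε = ∇ × b_ε` carries the derivative to the
kernel, so the flux is at most `ε⁻¹` times an average of `‖δj‖_p ‖δb‖_q ‖δb‖_q`, where
`p⁻¹ + 2 q⁻¹ = 1`. Because `2α + β ≥ 1`, these products are `o(ε) Q(t)`, with `Q` integrable by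
Young's inequality for `2/r₁ + 1/r₂ = 1`. Hence the flux tends to `0`, and the weak time derivative
of the energy vanishes. The dissipation integrand `∇φ_ε · δj |δb|²` is controlled by the same
products, again at the cost of a single factor `ε⁻¹`.

The annulus keeps `|ℓ|` comparable to `ε`, so that negative powers `α` or `β` do no harm.
-/

noncomputable section

namespace EMHD

open scoped ENNReal

lemma tendsto_integral_mul_of_tendsto_integral_norm_sub {X ι : Type*} [MeasurableSpace X]
    {μ : Measure X} {l : Filter ι} {f : ι → X → ℝ} {f₀ η : X → ℝ} {C : ℝ}
    (hf : ∀ᶠ n in l, Integrable (f n) μ) (hf₀ : Integrable f₀ μ)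
    (hη : AEStronglyMeasurable η μ) (hC : ∀ᵐ x ∂μ, ‖η x‖ ≤ C)
    (hlim : Tendsto (fun n => ∫ x, ‖f n x - f₀ x‖ ∂μ) l (𝓝 0)) :
    Tendsto (fun n => ∫ x, f n x * η x ∂μ) l (𝓝 (∫ x, f₀ x * η x ∂μ)) := by
  rw [tendsto_iff_norm_sub_tendsto_zero]
  refine squeeze_zero' (.of_forall fun _ => norm_nonneg _) ?_ (by simpa using hlim.mul_const C)
  filter_upwards [hf] with n hn
  rw [← integral_sub (hn.mul_bdd hη hC) (hf₀.mul_bdd hη hC), ← integral_mul_const]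
  refine norm_integral_le_of_norm_le ((hn.sub hf₀).norm.mul_const C) (hC.mono fun x hx => ?_)
  rw [← sub_mul, norm_mul]
  exact mul_le_mul_of_nonneg_left hx (norm_nonneg _)

section WeakDerivative

variable {a c : ℝ} {θ η g h g₁ h₁ g₂ h₂ : ℝ → ℝ}

/-- Scalar test functions of time, `θ ∈ C_c^∞((a, c))`. -/
structure IsTimeTest (a c : ℝ) (θ : ℝ → ℝ) : Prop where
  contDiff : ContDiff ℝ ∞ θ
  hasCompactSupport : HasCompactSupport θ
  tsupport_subset : tsupport θ ⊆ Ioo a c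

/-- `h` is the weak derivative of `g` on the interval `(a, c)`. -/
def HasWeakDeriv (a c : ℝ) (g h : ℝ → ℝ) : Prop :=
  ∀ θ, IsTimeTest a c θ → ∫ t in Ioo a c, g t * deriv θ t = -∫ t in Ioo a c, h t * θ t

namespace IsTimeTest

lemma of_eq_zero {a' c' : ℝ} (hθ : ContDiff ℝ ∞ θ) (ha : a < a') (hc : c' < c)
    (h0 : ∀ t, t ∉ Icc a' c' → θ t = 0) : IsTimeTest a c θ :=
  ⟨hθ, .intro isCompact_Icc h0,
    (closure_minimal (fun t ht => of_not_not (mt (h0 t) ht)) isClosed_Icc).trans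
      (Icc_subset_Ioo ha hc)⟩

lemma exists_Icc (hθ : IsTimeTest a c θ) :
    ∃ a' c', a < a' ∧ c' < c ∧ ∀ t, t ∉ Icc a' c' → θ t = 0 := by
  rcases (tsupport θ).eq_empty_or_nonempty with hempty | hne
  · exact ⟨a + 1, c - 1, by linarith, by linarith,
      fun t _ => image_eq_zero_of_notMem_tsupport (by simp [hempty])⟩
  · obtain ⟨x, hx⟩ := hθ.hasCompactSupport.isCompact.exists_isLeast hne
    obtain ⟨y, hy⟩ := hθ.hasCompactSupport.isCompact.exists_isGreatest hne
    exact ⟨x, y, (hθ.tsupport_subset hx.1).1, (hθ.tsupport_subset hy.1).2,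
      fun t ht => image_eq_zero_of_notMem_tsupport fun hs => ht ⟨hx.2 hs, hy.2 hs⟩⟩

lemma sub_const_mul (hθ : IsTimeTest a c θ) (hη : IsTimeTest a c η) (m : ℝ) :
    IsTimeTest a c (fun t => θ t - m * η t) where
  contDiff := hθ.contDiff.sub (contDiff_const.mul hη.contDiff)
  hasCompactSupport := hθ.hasCompactSupport.sub hη.hasCompactSupport.mul_left
  tsupport_subset := (tsupport_sub θ fun t => m * η t).trans <| union_subset hθ.tsupport_subset <|
    (tsupport_mul_subset_right (f := fun _ => m)).trans hη.tsupport_subset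

lemma eq_zero_of_notMem (hθ : IsTimeTest a c θ) {t : ℝ} (ht : t ∉ Ioo a c) : θ t = 0 :=
  image_eq_zero_of_notMem_tsupport fun hs => ht (hθ.tsupport_subset hs)

lemma continuous_deriv (hθ : IsTimeTest a c θ) : Continuous (deriv θ) :=
  hθ.contDiff.continuous_deriv (by simp)

lemma hasDerivAt (hθ : IsTimeTest a c θ) (t : ℝ) : HasDerivAt θ (deriv θ t) t :=
  (hθ.contDiff.differentiable (by simp) t).hasDerivAt

lemma integrable (hθ : IsTimeTest a c θ) : Integrable θ :=
  hθ.contDiff.continuous.integrable_of_hasCompactSupport hθ.hasCompactSupport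

lemma integrable_deriv (hθ : IsTimeTest a c θ) : Integrable (deriv θ) :=
  hθ.continuous_deriv.integrable_of_hasCompactSupport hθ.hasCompactSupport.deriv

lemma integrableOn_mul {s : Set ℝ} (hθ : IsTimeTest a c θ) (hg : IntegrableOn g s) :
    IntegrableOn (fun t => g t * θ t) s := by
  obtain ⟨C, hC⟩ := hθ.hasCompactSupport.exists_bound_of_continuous hθ.contDiff.continuous
  exact hg.mul_bdd hθ.contDiff.continuous.aestronglyMeasurable (ae_of_all _ hC)

lemma integrableOn_mul_deriv {s : Set ℝ} (hθ : IsTimeTest a c θ) (hg : IntegrableOn g s) :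
    IntegrableOn (fun t => g t * deriv θ t) s := by
  obtain ⟨C, hC⟩ := hθ.hasCompactSupport.deriv.exists_bound_of_continuous hθ.continuous_deriv
  exact hg.mul_bdd hθ.continuous_deriv.aestronglyMeasurable (ae_of_all _ hC)

lemma setIntegral_Ioo_mul (hθ : IsTimeTest a c θ) (g : ℝ → ℝ) :
    ∫ t in Ioo a c, g t * θ t = ∫ t, g t * θ t :=
  setIntegral_eq_integral_of_forall_compl_eq_zero fun t ht => by
    rw [hθ.eq_zero_of_notMem ht, mul_zero]

lemma deriv_eq_zero_of_notMem (hθ : IsTimeTest a c θ) {t : ℝ} (ht : t ∉ Ioo a c) :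
    deriv θ t = 0 :=
  image_eq_zero_of_notMem_tsupport fun hs => ht (hθ.tsupport_subset (tsupport_deriv_subset hs))

lemma setIntegral_Ioo_mul_deriv (hθ : IsTimeTest a c θ) (g : ℝ → ℝ) :
    ∫ t in Ioo a c, g t * deriv θ t = ∫ t, g t * deriv θ t :=
  setIntegral_eq_integral_of_forall_compl_eq_zero fun t ht => by
    rw [hθ.deriv_eq_zero_of_notMem ht, mul_zero]

lemma exists_subinterval (hθ : IsTimeTest a c θ) (hac : a < c) :
    ∃ a' c', a < a' ∧ a' < c' ∧ c' < c ∧ IsTimeTest a' c' θ := by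
  obtain ⟨x, y, hx, hy, hθ0⟩ := hθ.exists_Icc
  let m := (a + c) / 2
  have ham : a < m := by simp only [m]; linarith
  have hmc : m < c := by simp only [m]; linarith
  obtain ⟨a', ha, ha'⟩ := exists_between (lt_min hx ham)
  obtain ⟨c', hc', hc⟩ := exists_between (max_lt hy hmc)
  obtain ⟨hax, ham'⟩ := lt_min_iff.1 ha'
  obtain ⟨hyc, hmc'⟩ := max_lt_iff.1 hc'
  exact ⟨a', c', ha, ham'.trans hmc', hc, .of_eq_zero hθ.contDiff hax hyc hθ0⟩

lemma exists_primitive (hθ : IsTimeTest a c θ) (h0 : ∫ t, θ t = 0) :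
    ∃ η, IsTimeTest a c η ∧ deriv η = θ := by
  obtain ⟨a', c', ha, hc, hθ0⟩ := hθ.exists_Icc
  have hcont := hθ.contDiff.continuous
  have hderiv (t : ℝ) : HasDerivAt (fun t => ∫ s in a..t, θ s) (θ t) t :=
    intervalIntegral.integral_hasDerivAt_right (hcont.intervalIntegrable _ _)
      (hcont.stronglyMeasurableAtFilter _ _) hcont.continuousAt
  have hderiv_eq : deriv (fun t => ∫ s in a..t, θ s) = θ := funext fun t => (hderiv t).deriv
  refine ⟨fun t => ∫ s in a..t, θ s, .of_eq_zero ?_ ha hc fun t ht => ?_, hderiv_eq⟩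
  · rw [contDiff_infty_iff_deriv, hderiv_eq]
    exact ⟨fun t => (hderiv t).differentiableAt, hθ.contDiff⟩
  rcases lt_or_ge t a' with hta | hta
  · refine intervalIntegral.integral_zero_ae (ae_of_all _ fun s hs => hθ0 s fun hs' => ?_)
    exact absurd (hs.2.trans_lt (max_lt ha hta)) (not_lt.2 hs'.1)
  · have htc : c' < t := lt_of_not_ge fun htc => ht ⟨hta, htc⟩
    rw [intervalIntegral.integral_of_le (ha.le.trans hta), ← h0]
    exact setIntegral_eq_integral_of_forall_compl_eq_zero fun s hs =>
      hθ0 s fun hs' => hs ⟨ha.trans_le hs'.1, hs'.2.trans htc.le⟩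

lemma exists_deriv_eq_sub_integral_mul (hθ : IsTimeTest a c θ) (hη : IsTimeTest a c η)
    (hη1 : ∫ t, η t = 1) :
    ∃ ζ, IsTimeTest a c ζ ∧ deriv ζ = fun t => θ t - (∫ s, θ s) * η t := by
  refine (hθ.sub_const_mul hη _).exists_primitive ?_
  rw [integral_sub hθ.integrable (hη.integrable.const_mul _), integral_const_mul, hη1, mul_one,
    sub_self]

end IsTimeTest

lemma exists_isTimeTest_integral_eq_one (hac : a < c) :
    ∃ θ, IsTimeTest a c θ ∧ (∀ t, 0 ≤ θ t) ∧ ∫ t, θ t = 1 := by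
  let f : ContDiffBump ((a + c) / 2) :=
    { rIn := (c - a) / 8, rOut := (c - a) / 4, rIn_pos := by linarith, rIn_lt_rOut := by linarith }
  refine ⟨f.normed volume, ⟨f.contDiff_normed, f.hasCompactSupport_normed, ?_⟩, f.nonneg_normed,
    f.integral_normed⟩
  rw [f.tsupport_normed_eq, Real.closedBall_eq_Icc]
  exact Icc_subset_Ioo (by simp only [f]; linarith) (by simp only [f]; linarith)

namespace HasWeakDeriv

lemma of_absolutelyContinuous (hac : a ≤ c)
    (hg : AbsolutelyContinuousOnInterval g a c) : HasWeakDeriv a c g (deriv g) := by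
  intro θ hθ
  have hθac : AbsolutelyContinuousOnInterval θ a c :=
    (hθ.contDiff.of_le (by simp)).contDiffOn.absolutelyContinuousOnInterval
  have hparts := hg.integral_mul_deriv_eq_deriv_mul hθac
  rwa [hθ.eq_zero_of_notMem (t := a) (by simp), hθ.eq_zero_of_notMem (t := c) (by simp),
    intervalIntegral.integral_of_le hac, intervalIntegral.integral_of_le hac,
    integral_Ioc_eq_integral_Ioo, integral_Ioc_eq_integral_Ioo, mul_zero, mul_zero, sub_zero,
    zero_sub] at hparts

lemma congr (H : HasWeakDeriv a c g₁ h₁) (hg : g₁ =ᵐ[volume.restrict (Ioo a c)] g₂)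
    (hh : h₁ =ᵐ[volume.restrict (Ioo a c)] h₂) : HasWeakDeriv a c g₂ h₂ := fun θ hθ => by
  have hg' : ∫ t in Ioo a c, g₁ t * deriv θ t = ∫ t in Ioo a c, g₂ t * deriv θ t :=
    integral_congr_ae (hg.mono fun t ht => by simp only [ht])
  have hh' : ∫ t in Ioo a c, h₁ t * θ t = ∫ t in Ioo a c, h₂ t * θ t :=
    integral_congr_ae (hh.mono fun t ht => by simp only [ht])
  rw [← hg', H θ hθ, hh']

lemma sub (H₁ : HasWeakDeriv a c g₁ h₁) (H₂ : HasWeakDeriv a c g₂ h₂)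
    (hg₁ : IntegrableOn g₁ (Ioo a c)) (hh₁ : IntegrableOn h₁ (Ioo a c))
    (hg₂ : IntegrableOn g₂ (Ioo a c)) (hh₂ : IntegrableOn h₂ (Ioo a c)) :
    HasWeakDeriv a c (g₁ - g₂) (h₁ - h₂) := fun θ hθ => by
  simp only [Pi.sub_apply, sub_mul]
  rw [integral_sub (hθ.integrableOn_mul_deriv hg₁) (hθ.integrableOn_mul_deriv hg₂),
    integral_sub (hθ.integrableOn_mul hh₁) (hθ.integrableOn_mul hh₂), H₁ θ hθ, H₂ θ hθ]
  ring

lemma ae_eq_const (hac : a < c) (hg : IntegrableOn g (Ioo a c)) (H : HasWeakDeriv a c g 0) :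
    ∃ k, ∀ᵐ t ∂(volume.restrict (Ioo a c)), g t = k := by
  obtain ⟨η, hη, -, hη1⟩ := exists_isTimeTest_integral_eq_one hac
  let k := ∫ t in Ioo a c, g t * η t
  suffices h0 : ∀ θ, IsTimeTest a c θ → ∫ t, θ t • (g t - k) = 0 by
    have hloc : LocallyIntegrableOn (fun t => g t - k) (Ioo a c) :=
      (hg.sub (integrableOn_const (by simp))).locallyIntegrableOn
    have hzero := isOpen_Ioo.ae_eq_zero_of_integral_contDiff_smul_eq_zero hloc
      fun θ hθ hθc hθs => h0 θ ⟨hθ, hθc, hθs⟩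
    exact ⟨k, (ae_restrict_iff' measurableSet_Ioo).2
      (hzero.mono fun t ht hmem => sub_eq_zero.1 (ht hmem))⟩
  intro θ hθ
  obtain ⟨ζ, hζ, hζ_deriv⟩ := hθ.exists_deriv_eq_sub_integral_mul hη hη1
  have htest : ∫ t in Ioo a c, g t * θ t = (∫ t, θ t) * k := by
    have hweak := H ζ hζ
    simp only [hζ_deriv, mul_sub, mul_left_comm (g _), Pi.zero_apply, zero_mul, integral_zero,
      neg_zero] at hweak
    rwa [integral_sub (hθ.integrableOn_mul hg) ((hη.integrableOn_mul hg).const_mul _),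
      integral_const_mul, sub_eq_zero] at hweak
  simp only [smul_eq_mul, mul_comm (θ _)]
  rw [← hθ.setIntegral_Ioo_mul fun t => g t - k]
  simp only [sub_mul]
  rw [integral_sub (hθ.integrableOn_mul hg) (hθ.integrable.integrableOn.const_mul k), htest,
    hθ.setIntegral_Ioo_mul fun _ => k, integral_const_mul]
  ring

lemma exists_absolutelyContinuous (hac : a < c) (hg : IntegrableOn g (Ioo a c))
    (hh : IntegrableOn h (Ioo a c)) (H : HasWeakDeriv a c g h) :
    ∃ G : ℝ → ℝ, AbsolutelyContinuousOnInterval G a c ∧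
      (∀ᵐ t ∂(volume.restrict (Ioo a c)), g t = G t) ∧
      ∀ᵐ t ∂(volume.restrict (Ioo a c)), HasDerivAt G (h t) t := by
  have hhi : IntervalIntegrable h volume a c :=
    (intervalIntegrable_iff_integrableOn_Ioo_of_le hac.le).2 hh
  let P : ℝ → ℝ := fun t => ∫ s in a..t, h s
  have hP : AbsolutelyContinuousOnInterval P a c :=
    hhi.absolutelyContinuousOnInterval_intervalIntegral (by simp)
  have hP_deriv : ∀ᵐ t ∂(volume.restrict (Ioo a c)), HasDerivAt P (h t) t := by
    rw [ae_restrict_iff' measurableSet_Ioo]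
    filter_upwards [hhi.ae_hasDerivAt_integral] with t ht hmem
    exact ht (by rw [uIcc_of_le hac.le]; exact Ioo_subset_Icc_self hmem) a (by simp)
  have hP_int : IntegrableOn P (Ioo a c) :=
    (intervalIntegrable_iff_integrableOn_Ioo_of_le hac.le).1
      hP.continuousOn.intervalIntegrable
  have hP_weak : HasWeakDeriv a c P h :=
    (of_absolutelyContinuous hac.le hP).congr (.refl _ _)
      (hP_deriv.mono fun t ht => ht.deriv)
  obtain ⟨k, hk⟩ := ae_eq_const (g := g - P) hac (hg.sub hP_int)
    (by simpa using H.sub hP_weak hg hh hP_int hh)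
  have hconst : AbsolutelyContinuousOnInterval (fun _ : ℝ => k) a c :=
    contDiffOn_const.absolutelyContinuousOnInterval
  exact ⟨fun t => P t + k, hP.add hconst, hk.mono fun t ht => sub_eq_iff_eq_add'.1 ht,
    hP_deriv.mono fun t ht => ht.add_const k⟩

lemma integrableOn_mul (hac : a < c) (hg : IntegrableOn g (Ioo a c))
    (hh : IntegrableOn h (Ioo a c)) (H : HasWeakDeriv a c g h) {k : ℝ → ℝ}
    (hk : IntegrableOn k (Ioo a c)) : IntegrableOn (fun t => k t * g t) (Ioo a c) := by
  obtain ⟨G, hG, hgG, -⟩ := H.exists_absolutelyContinuous hac hg hh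
  obtain ⟨C, hC⟩ := isCompact_uIcc.exists_bound_of_continuousOn hG.continuousOn
  refine hk.mul_bdd (c := C) hg.aestronglyMeasurable ?_
  filter_upwards [hgG, ae_restrict_mem measurableSet_Ioo] with t ht hmem
  rw [ht]
  exact hC t (by rw [uIcc_of_le hac.le]; exact Ioo_subset_Icc_self hmem)

lemma mul (hac : a < c) (hg₁ : IntegrableOn g₁ (Ioo a c)) (hh₁ : IntegrableOn h₁ (Ioo a c))
    (hg₂ : IntegrableOn g₂ (Ioo a c)) (hh₂ : IntegrableOn h₂ (Ioo a c))
    (H₁ : HasWeakDeriv a c g₁ h₁) (H₂ : HasWeakDeriv a c g₂ h₂) :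
    HasWeakDeriv a c (fun t => g₁ t * g₂ t) (fun t => h₁ t * g₂ t + g₁ t * h₂ t) := by
  obtain ⟨G₁, hG₁, hgG₁, hG₁'⟩ := H₁.exists_absolutelyContinuous hac hg₁ hh₁
  obtain ⟨G₂, hG₂, hgG₂, hG₂'⟩ := H₂.exists_absolutelyContinuous hac hg₂ hh₂
  refine (of_absolutelyContinuous hac.le (hG₁.mul hG₂)).congr ?_ ?_
  · filter_upwards [hgG₁, hgG₂] with t ht₁ ht₂
    rw [Pi.mul_apply, ht₁, ht₂]
  · filter_upwards [hgG₁, hgG₂, hG₁', hG₂'] with t ht₁ ht₂ ht₁' ht₂'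
    rw [(ht₁'.mul ht₂').deriv, ht₁, ht₂]

lemma sum {ι : Type*} {s : Finset ι} {g h : ι → ℝ → ℝ}
    (H : ∀ i ∈ s, HasWeakDeriv a c (g i) (h i)) (hg : ∀ i ∈ s, IntegrableOn (g i) (Ioo a c))
    (hh : ∀ i ∈ s, IntegrableOn (h i) (Ioo a c)) :
    HasWeakDeriv a c (fun t => ∑ i ∈ s, g i t) (fun t => ∑ i ∈ s, h i t) := fun θ hθ => by
  simp only [Finset.sum_mul]
  rw [integral_finsetSum _ fun i hi => hθ.integrableOn_mul_deriv (hg i hi),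
    integral_finsetSum _ fun i hi => hθ.integrableOn_mul (hh i hi), ← Finset.sum_neg_distrib]
  exact Finset.sum_congr rfl fun i hi => H i hi θ hθ

lemma integral {X : Type*} [MeasurableSpace X] {μ : Measure X} [SFinite μ] {g h : ℝ → X → ℝ}
    (H : ∀ᵐ x ∂μ, HasWeakDeriv a c (fun t => g t x) (fun t => h t x))
    (hg : Integrable (fun p : ℝ × X => g p.1 p.2) ((volume.restrict (Ioo a c)).prod μ))
    (hh : Integrable (fun p : ℝ × X => h p.1 p.2) ((volume.restrict (Ioo a c)).prod μ)) :
    HasWeakDeriv a c (fun t => ∫ x, g t x ∂μ) (fun t => ∫ x, h t x ∂μ) := fun θ hθ => by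
  have swap {f : ℝ → X → ℝ} {η : ℝ → ℝ} (hη : Continuous η) (hηc : HasCompactSupport η)
      (hf : Integrable (fun p : ℝ × X => f p.1 p.2) ((volume.restrict (Ioo a c)).prod μ)) :
      ∫ t in Ioo a c, (∫ x, f t x ∂μ) * η t = ∫ x, (∫ t in Ioo a c, f t x * η t) ∂μ := by
    obtain ⟨C, hC⟩ := hηc.exists_bound_of_continuous hη
    simp only [← integral_mul_const]
    exact integral_integral_swap (f := fun t x => f t x * η t) <|
      hf.mul_bdd hη.aestronglyMeasurable.comp_fst (ae_of_all _ fun p => hC p.1)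
  rw [swap hθ.continuous_deriv hθ.hasCompactSupport.deriv hg,
    swap hθ.contDiff.continuous hθ.hasCompactSupport hh, ← integral_neg]
  exact integral_congr_ae (H.mono fun x hx => hx θ hθ)

lemma of_tendsto {ι : Type*} {l : Filter ι} [l.NeBot] {g h : ι → ℝ → ℝ} {g₀ h₀ : ℝ → ℝ}
    (H : ∀ᶠ n in l, HasWeakDeriv a c (g n) (h n))
    (hg : ∀ᶠ n in l, IntegrableOn (g n) (Ioo a c)) (hg₀ : IntegrableOn g₀ (Ioo a c))
    (hh : ∀ᶠ n in l, IntegrableOn (h n) (Ioo a c)) (hh₀ : IntegrableOn h₀ (Ioo a c))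
    (hg_tendsto : Tendsto (fun n => ∫ t in Ioo a c, ‖g n t - g₀ t‖) l (𝓝 0))
    (hh_tendsto : Tendsto (fun n => ∫ t in Ioo a c, ‖h n t - h₀ t‖) l (𝓝 0)) :
    HasWeakDeriv a c g₀ h₀ := fun θ hθ => by
  obtain ⟨C, hC⟩ := hθ.hasCompactSupport.exists_bound_of_continuous hθ.contDiff.continuous
  obtain ⟨C', hC'⟩ := hθ.hasCompactSupport.deriv.exists_bound_of_continuous hθ.continuous_deriv
  have hlim_h := tendsto_integral_mul_of_tendsto_integral_norm_sub hh hh₀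
    hθ.contDiff.continuous.aestronglyMeasurable (ae_of_all _ hC) hh_tendsto
  exact tendsto_nhds_unique (tendsto_integral_mul_of_tendsto_integral_norm_sub hg hg₀
    hθ.continuous_deriv.aestronglyMeasurable (ae_of_all _ hC') hg_tendsto)
    (hlim_h.neg.congr' (H.mono fun n hn => (hn θ hθ).symm))

lemma of_subintervals
    (H : ∀ a' c', a < a' → a' < c' → c' < c → HasWeakDeriv a' c' g h) :
    HasWeakDeriv a c g h := fun θ hθ => by
  rcases le_or_gt c a with hca | hac
  · simp [Ioo_eq_empty_of_le hca]
  obtain ⟨a', c', ha, hac', hc, hθ'⟩ := hθ.exists_subinterval hac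
  rw [hθ.setIntegral_Ioo_mul, hθ.setIntegral_Ioo_mul_deriv, ← hθ'.setIntegral_Ioo_mul,
    ← hθ'.setIntegral_Ioo_mul_deriv, H a' c' ha hac' hc θ hθ']

end HasWeakDeriv

end WeakDerivative

section Torus

variable {L : ℝ}

lemma proj_add (y z : E3) : proj L (y + z) = proj L y + proj L z := rfl

lemma proj_neg (y : E3) : proj L (-y) = -proj L y := rfl

lemma isOpenQuotientMap_proj : IsOpenQuotientMap (proj L) :=
  (IsOpenQuotientMap.piMap fun _ : Fin 3 => QuotientAddGroup.isOpenQuotientMap_mk).comp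
    (EuclideanSpace.equiv (Fin 3) ℝ).toHomeomorph.isOpenQuotientMap

lemma continuous_proj : Continuous (proj L) := isOpenQuotientMap_proj.continuous

lemma proj_surjective : Function.Surjective (proj L) := isOpenQuotientMap_proj.surjective

/-- The gradient of a scalar function on the torus. -/
def torusGrad (f : Torus L → ℝ) (x : Torus L) : E3 := WithLp.toLp 2 fun i => pderiv i f x

@[simp] lemma torusGrad_apply (f : Torus L → ℝ) (x : Torus L) (i : Fin 3) :
    torusGrad f x i = pderiv i f x := rfl

lemma pderiv_proj (f : Torus L → ℝ) (i : Fin 3) (y : E3) :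
    pderiv i f (proj L y) = lineDeriv ℝ (fun y => f (proj L y)) y (EuclideanSpace.single i 1) := by
  have hsingle (s : ℝ) : EuclideanSpace.single i s = s • EuclideanSpace.single i (1 : ℝ) := by
    ext j; simp
  simp only [pderiv, lineDeriv, ← proj_add, ← hsingle]

lemma pderiv_comp_sub_right (f : Torus L → ℝ) (i : Fin 3) (x y : Torus L) :
    pderiv i (fun y => f (y - x)) y = pderiv i f (y - x) := by
  simp only [pderiv, add_sub_right_comm]

lemma pderiv_comp_const_sub (f : Torus L → ℝ) (i : Fin 3) (x y : Torus L) :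
    pderiv i (fun y => f (x - y)) y = -pderiv i f (x - y) := by
  have hreflect (s : ℝ) : f (x - (y + proj L (EuclideanSpace.single i s)))
      = (fun s => f (x - y + proj L (EuclideanSpace.single i s))) (-s) := by
    simp only [PiLp.single_neg, proj_neg, ← sub_eq_add_neg, sub_add_eq_sub_sub]
  simp only [pderiv, hreflect]
  rw [deriv_comp_neg (f := fun s => f (x - y + proj L (EuclideanSpace.single i s))), neg_zero]

lemma torusGrad_comp_sub_right (f : Torus L → ℝ) (x y : Torus L) :
    torusGrad (fun y => f (y - x)) y = torusGrad f (y - x) := by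
  ext i
  exact pderiv_comp_sub_right f i x y

lemma torusGrad_comp_const_sub (f : Torus L → ℝ) (x y : Torus L) :
    torusGrad (fun y => f (x - y)) y = -torusGrad f (x - y) := by
  ext i
  exact pderiv_comp_const_sub f i x y

lemma torusGrad_const_mul (f : Torus L → ℝ) (c : ℝ) (y : Torus L) :
    torusGrad (fun y => c * f y) y = c • torusGrad f y := by
  ext i
  simp [pderiv, deriv_const_mul_field]

lemma curl_smul_const (f : Torus L → ℝ) (e : E3) (x : Torus L) :
    curl (fun y => f y • e) x = cross (torusGrad f x) e := by
  ext i
  fin_cases i <;> simp [curl, cross, pderiv, deriv_mul_const_field]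

namespace IsSmooth

variable {F : Type} [NormedAddCommGroup F] [NormedSpace ℝ F]

lemma continuous {f : Torus L → F} (hf : IsSmooth f) : Continuous f :=
  isOpenQuotientMap_proj.continuous_comp_iff.1 (ContDiff.continuous hf)

lemma comp_sub_right {f : Torus L → F} (hf : IsSmooth f) (x : Torus L) :
    IsSmooth fun y => f (y - x) := by
  obtain ⟨x, rfl⟩ := proj_surjective x
  exact ContDiff.comp (g := fun y => f (proj L y)) hf (contDiff_id.sub (contDiff_const (c := x)))

lemma comp_const_sub {f : Torus L → F} (hf : IsSmooth f) (x : Torus L) :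
    IsSmooth fun y => f (x - y) := by
  obtain ⟨x, rfl⟩ := proj_surjective x
  exact ContDiff.comp (g := fun y => f (proj L y)) hf ((contDiff_const (c := x)).sub contDiff_id)

lemma smul_const {f : Torus L → ℝ} (hf : IsSmooth f) (e : F) : IsSmooth fun y => f y • e :=
  ContDiff.smul hf contDiff_const

lemma pderiv {f : Torus L → ℝ} (hf : IsSmooth f) (i : Fin 3) : IsSmooth (pderiv i f) := by
  have hf' : ContDiff ℝ ∞ fun y => f (proj L y) := hf
  simp only [IsSmooth, pderiv_proj, (hf'.differentiable (by simp) _).lineDeriv_eq_fderiv]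
  exact (hf'.fderiv_right (m := ∞) (by simp)).clm_apply contDiff_const

lemma continuous_torusGrad {f : Torus L → ℝ} (hf : IsSmooth f) : Continuous (torusGrad f) :=
  (PiLp.continuous_toLp 2 _).comp (continuous_pi fun i => (hf.pderiv i).continuous)

end IsSmooth

variable [Fact (0 < L)]

instance : IsFiniteMeasure (volume : Measure (Torus L)) := by
  unfold Torus; infer_instance

instance : MeasurableAdd₂ (Torus L) := by
  unfold Torus; infer_instance

lemma exists_bound_of_continuous {F : Type*} [NormedAddCommGroup F] {f : Torus L → F}
    (hf : Continuous f) : ∃ C, ∀ x, ‖f x‖ ≤ C := by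
  simpa using isCompact_univ.exists_bound_of_continuousOn hf.continuousOn

lemma integrable_of_continuous {F : Type*} [NormedAddCommGroup F] {f : Torus L → F}
    (hf : Continuous f) : Integrable f :=
  hf.integrable_of_hasCompactSupport (.of_compactSpace f)

end Torus

section VectorProduct

/-- The vector product as a continuous bilinear map. -/
def crossL : E3 →L[ℝ] E3 →L[ℝ] E3 :=
  LinearMap.toContinuousBilinearMap <| LinearMap.mk₂ ℝ cross
    (by intro u v w; ext i; fin_cases i <;> simp [cross] <;> ring)
    (by intro c u v; ext i; fin_cases i <;> simp [cross] <;> ring)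
    (by intro u v w; ext i; fin_cases i <;> simp [cross] <;> ring)
    (by intro c u v; ext i; fin_cases i <;> simp [cross] <;> ring)

@[simp] lemma crossL_apply (u v : E3) : crossL u v = cross u v := rfl

lemma continuous_cross : Continuous fun p : E3 × E3 => cross p.1 p.2 :=
  crossL.continuous₂

lemma inner_eq_sum (u v : E3) : inner ℝ u v = ∑ i, u i * v i := by
  simp only [PiLp.inner_apply, RCLike.inner_apply, conj_trivial, mul_comm]

lemma norm_cross_le (u v : E3) : ‖cross u v‖ ≤ ‖u‖ * ‖v‖ := by
  rw [← sq_le_sq₀ (norm_nonneg _) (by positivity), mul_pow]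
  simp only [EuclideanSpace.real_norm_sq_eq, Fin.sum_univ_three, cross,
    Matrix.cons_val]
  -- Lagrange's identity: `|u|² |v|² - |u × v|² = (u · v)²`
  nlinarith [sq_nonneg (u 0 * v 0 + u 1 * v 1 + u 2 * v 2)]

lemma inner_cross_cyclic (u v w : E3) : inner ℝ u (cross v w) = inner ℝ (cross u v) w := by
  simp [inner_eq_sum, Fin.sum_univ_three, cross]; ring

lemma inner_cross_self_left (u v : E3) : inner ℝ (cross u v) u = 0 := by
  simp [inner_eq_sum, Fin.sum_univ_three, cross]; ring

lemma norm_le_sum_abs {ι : Type*} [Fintype ι] (u : EuclideanSpace ℝ ι) :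
    ‖u‖ ≤ ∑ i, |u i| := by
  classical
  calc ‖u‖ = ‖∑ i, u i • EuclideanSpace.single i (1 : ℝ)‖ := by
        conv_lhs => rw [← (EuclideanSpace.basisFun ι ℝ).sum_repr u]
        simp
    _ ≤ ∑ i, |u i| := (norm_sum_le _ _).trans_eq (by simp [norm_smul])

end VectorProduct

section Periodization

open Function

variable {L : ℝ} [hL : Fact (0 < L)] {a c : ℝ} {f : ℝ → ℝ}

lemma liftIco_coe_eq_of_mem (ha : 0 < a) (hac : a ≤ c) (hc : c < L) (hf : support f ⊆ Icc a c)
    {y : ℝ} (hy : y ∈ Ioo (c - L) (L + a)) : AddCircle.liftIco L 0 f y = f y := by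
  have hf0 (t : ℝ) (ht : t < a ∨ c < t) : f t = 0 :=
    notMem_support.1 fun hs => ht.elim (hf hs).1.not_gt (hf hs).2.not_gt
  obtain ⟨hy₁, hy₂⟩ := hy
  rcases lt_or_ge y 0 with hneg | hnonneg
  · rw [← AddCircle.coe_add_period L y, AddCircle.liftIco_zero_coe_apply ⟨by linarith, by linarith⟩,
      hf0 _ (.inr (by linarith)), hf0 _ (.inl (by linarith))]
  rcases lt_or_ge y L with hlt | hge
  · exact AddCircle.liftIco_zero_coe_apply ⟨hnonneg, hlt⟩
  · rw [← sub_add_cancel y L, AddCircle.coe_add_period,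
      AddCircle.liftIco_zero_coe_apply ⟨by linarith, by linarith⟩,
      hf0 _ (.inl (by linarith)), hf0 _ (.inr (by linarith))]

lemma exists_liftIco_eventuallyEq (ha : 0 < a) (hac : a ≤ c) (hc : c < L) (y : ℝ) :
    ∃ r : ℝ, ∀ f : ℝ → ℝ, support f ⊆ Icc a c →
      (fun s : ℝ => AddCircle.liftIco L 0 f s) =ᶠ[𝓝 y] fun s => f (s - r) := by
  refine ⟨⌊y / L⌋ • L, fun f hf => ?_⟩
  have hfloor : ⌊y / L⌋ • L ≤ y := by
    simpa using (le_div_iff₀ hL.out).1 (Int.floor_le (y / L))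
  have hlt : y < ⌊y / L⌋ • L + L := by
    simpa [add_mul] using (div_lt_iff₀ hL.out).1 (Int.lt_floor_add_one (y / L))
  have hnhds : Ioo (c - L + ⌊y / L⌋ • L) (L + a + ⌊y / L⌋ • L) ∈ 𝓝 y :=
    Ioo_mem_nhds (by linarith) (by linarith)
  filter_upwards [hnhds] with s hs
  have hcoe : (s : AddCircle L) = ((s - ⌊y / L⌋ • L : ℝ) : AddCircle L) := by
    rw [AddCircle.coe_sub, AddCircle.coe_zsmul, AddCircle.coe_period, smul_zero, sub_zero]
  rw [hcoe]
  exact liftIco_coe_eq_of_mem ha hac hc hf ⟨by linarith [hs.1], by linarith [hs.2]⟩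

lemma contDiff_liftIco (ha : 0 < a) (hac : a ≤ c) (hc : c < L) (hf : support f ⊆ Icc a c)
    (hsmooth : ContDiff ℝ ∞ f) : ContDiff ℝ ∞ fun s : ℝ => AddCircle.liftIco L 0 f s := by
  refine contDiff_iff_contDiffAt.2 fun y => ?_
  obtain ⟨r, hr⟩ := exists_liftIco_eventuallyEq (L := L) ha hac hc y
  exact (hsmooth.comp (contDiff_id.sub contDiff_const)).contDiffAt.congr_of_eventuallyEq (hr f hf)

lemma support_deriv_subset_Icc (hf : support f ⊆ Icc a c) : support (deriv f) ⊆ Icc a c :=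
  support_deriv_subset.trans (closure_minimal hf isClosed_Icc)

lemma hasDerivAt_liftIco (ha : 0 < a) (hac : a ≤ c) (hc : c < L) (hf : support f ⊆ Icc a c)
    (hdiff : Differentiable ℝ f) (y : ℝ) :
    HasDerivAt (fun s : ℝ => AddCircle.liftIco L 0 f s) (AddCircle.liftIco L 0 (deriv f) y) y := by
  obtain ⟨r, hr⟩ := exists_liftIco_eventuallyEq (L := L) ha hac hc y
  rw [(hr _ (support_deriv_subset_Icc hf)).eq_of_nhds]
  exact ((hdiff (y - r)).hasDerivAt.comp_sub_const y r).congr_of_eventuallyEq (hr f hf)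

lemma integral_liftIco (ha : 0 < a) (hac : a ≤ c) (hc : c < L) (hf : support f ⊆ Icc a c) :
    ∫ z : AddCircle L, AddCircle.liftIco L 0 f z = ∫ t, f t := by
  rw [← AddCircle.integral_preimage L 0, ← setIntegral_eq_integral_of_forall_compl_eq_zero
    (s := Ioc 0 (0 + L)) (f := f)]
  · exact setIntegral_congr_fun measurableSet_Ioc fun y hy =>
      liftIco_coe_eq_of_mem ha hac hc hf ⟨by linarith [hy.1], by linarith [hy.2]⟩
  · exact fun t ht => notMem_support.1 fun hs =>
      ht ⟨by linarith [(hf hs).1], by linarith [(hf hs).2]⟩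

lemma exists_mem_of_liftIco_ne_zero (hf : support f ⊆ Icc a c) {z : AddCircle L}
    (hz : AddCircle.liftIco L 0 f z ≠ 0) : ∃ y ∈ Icc a c, (y : AddCircle L) = z :=
  ⟨AddCircle.equivIco L 0 z, hf hz, AddCircle.coe_equivIco⟩

end Periodization

section Kernel

variable {L : ℝ} [Fact (0 < L)]

/-- A mollifier `κ`, with derivative `κ'`, on the circle `ℝ / Lℤ` which is supported in
`[ε, 2ε]`; the constant `A` controls the total variation of `κ`. -/
structure IsCircleMollifier (ε A : ℝ) (κ κ' : AddCircle L → ℝ) : Prop where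
  contDiff : ContDiff ℝ ∞ fun s : ℝ => κ s
  hasDerivAt (s : ℝ) : HasDerivAt (fun s : ℝ => κ s) (κ' s) s
  nonneg (z : AddCircle L) : 0 ≤ κ z
  integral_eq_one : ∫ z, κ z = 1
  integral_deriv : ∫ z, κ' z = 0
  integral_abs_deriv_le : ∫ z, |κ' z| ≤ A / ε
  exists_mem_Icc {z : AddCircle L} : κ z ≠ 0 ∨ κ' z ≠ 0 → ∃ y ∈ Icc ε (2 * ε), (y : AddCircle L) = z

/-- A mollifier on the torus that is supported away from the origin, at distance comparable
to `ε`. On its support `|ℓ| ^ α` is comparable to `ε ^ α` whatever the sign of `α`. -/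
structure IsAnnularKernel (ε A : ℝ) (K : Torus L → ℝ) : Prop where
  smooth : IsSmooth K
  nonneg (z : Torus L) : 0 ≤ K z
  integral_eq_one : ∫ z, K z = 1
  integral_grad : ∫ z, torusGrad K z = 0
  integral_norm_grad_le : ∫ z, ‖torusGrad K z‖ ≤ A / ε
  exists_proj_eq {z : Torus L} :
    K z ≠ 0 ∨ torusGrad K z ≠ 0 → ∃ ℓ : E3, proj L ℓ = z ∧ ε ≤ ‖ℓ‖ ∧ ‖ℓ‖ ≤ 4 * ε

lemma IsTimeTest.integral_deriv {a c : ℝ} {θ : ℝ → ℝ} (hθ : IsTimeTest a c θ) :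
    ∫ t, deriv θ t = 0 :=
  integral_eq_zero_of_hasDerivAt_of_integrable hθ.hasDerivAt hθ.integrable_deriv hθ.integrable

lemma integral_inv_mul_comp_inv_mul (g : ℝ → ℝ) {ε : ℝ} (hε : 0 < ε) :
    ∫ t, ε⁻¹ * g (ε⁻¹ * t) = ∫ t, g t := by
  rw [integral_const_mul, Measure.integral_comp_mul_left, inv_inv, abs_of_pos hε, smul_eq_mul,
    inv_mul_cancel_left₀ hε.ne']

lemma exists_isCircleMollifier : ∃ A : ℝ, 0 ≤ A ∧ ∀ L [Fact (0 < L)] ε, 0 < ε → 2 * ε < L →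
    ∃ κ κ' : AddCircle L → ℝ, IsCircleMollifier ε A κ κ' := by
  obtain ⟨θ, hθ, hθ0, hθ1⟩ := exists_isTimeTest_integral_eq_one (a := 1) (c := 2) (by norm_num)
  refine ⟨∫ t, |deriv θ t|, integral_nonneg fun _ => abs_nonneg _, fun L _ ε hε hεL => ?_⟩
  let f : ℝ → ℝ := fun t => ε⁻¹ * θ (ε⁻¹ * t)
  have hf_smooth : ContDiff ℝ ∞ f :=
    contDiff_const.mul (hθ.contDiff.comp (contDiff_const.mul contDiff_id))
  have hf_deriv : deriv f = fun t => ε⁻¹ * (ε⁻¹ * deriv θ (ε⁻¹ * t)) := by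
    ext t
    simp only [f, deriv_const_mul_field, deriv_comp_mul_left, smul_eq_mul]
  have hf_support : Function.support f ⊆ Icc ε (2 * ε) := by
    intro t ht
    by_contra hmem
    refine right_ne_zero_of_mul ht (hθ.eq_zero_of_notMem fun ⟨h₁, h₂⟩ => hmem ⟨?_, ?_⟩)
    · exact ((one_lt_inv_mul₀ hε).1 h₁).le
    · rw [inv_mul_lt_iff₀ hε] at h₂
      linarith
  have hle : ε ≤ 2 * ε := by linarith
  have hf_support' := support_deriv_subset_Icc hf_support
  refine ⟨AddCircle.liftIco L 0 f, AddCircle.liftIco L 0 (deriv f),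
    contDiff_liftIco hε hle hεL hf_support hf_smooth,
    hasDerivAt_liftIco hε hle hεL hf_support (hf_smooth.differentiable (by simp)),
    fun z => mul_nonneg (inv_nonneg.2 hε.le) (hθ0 _), ?_, ?_, ?_, fun hz => ?_⟩
  · rw [integral_liftIco hε hle hεL hf_support, integral_inv_mul_comp_inv_mul θ hε, hθ1]
  · rw [integral_liftIco hε hle hεL hf_support', hf_deriv, integral_const_mul,
      integral_inv_mul_comp_inv_mul (deriv θ) hε, hθ.integral_deriv, mul_zero]
  · have habs : ∫ z : AddCircle L, |AddCircle.liftIco L 0 (deriv f) z| = ∫ t, |deriv f t| :=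
      integral_liftIco (f := fun t => |deriv f t|) hε hle hεL
        fun t ht => hf_support' (abs_ne_zero.1 ht)
    rw [habs]
    simp only [hf_deriv, abs_mul, abs_of_pos (inv_pos.2 hε)]
    rw [integral_const_mul, integral_inv_mul_comp_inv_mul (fun t => |deriv θ t|) hε,
      inv_mul_eq_div]
  · exact hz.elim (exists_mem_of_liftIco_ne_zero hf_support)
      (exists_mem_of_liftIco_ne_zero hf_support')

/-- The tensor power `κ ⊗ κ ⊗ κ`, a function on the torus. -/
def tensorCube (κ : AddCircle L → ℝ) (z : Torus L) : ℝ := ∏ i, κ (z i)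

lemma norm_mem_Icc_of_forall_mem {ε : ℝ} (hε : 0 < ε) {y : E3}
    (hy : ∀ i, y i ∈ Icc ε (2 * ε)) : ε ≤ ‖y‖ ∧ ‖y‖ ≤ 4 * ε := by
  have hsq (i) : ε ^ 2 ≤ y i ^ 2 ∧ y i ^ 2 ≤ (2 * ε) ^ 2 :=
    ⟨pow_le_pow_left₀ hε.le (hy i).1 2, pow_le_pow_left₀ (hε.le.trans (hy i).1) (hy i).2 2⟩
  have hnorm : ‖y‖ ^ 2 = y 0 ^ 2 + y 1 ^ 2 + y 2 ^ 2 := by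
    rw [EuclideanSpace.real_norm_sq_eq, Fin.sum_univ_three]
  constructor
  · rw [← sq_le_sq₀ hε.le (norm_nonneg _), hnorm]
    nlinarith [hsq 0, hsq 1, hsq 2]
  · rw [← sq_le_sq₀ (norm_nonneg _) (by positivity), hnorm]
    nlinarith [hsq 0, hsq 1, hsq 2]

namespace IsCircleMollifier

variable {ε A : ℝ} {κ κ' : AddCircle L → ℝ}

lemma isSmooth_tensorCube (hκ : IsCircleMollifier ε A κ κ') : IsSmooth (tensorCube κ) :=
  contDiff_prod fun j _ => hκ.contDiff.comp (EuclideanSpace.proj (𝕜 := ℝ) j).contDiff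

lemma pderiv_tensorCube (hκ : IsCircleMollifier ε A κ κ') (i : Fin 3) (z : Torus L) :
    pderiv i (tensorCube κ) z = ∏ j, (if j = i then κ' else κ) (z j) := by
  obtain ⟨y, rfl⟩ := proj_surjective z
  have hslice (s : ℝ) : tensorCube κ (proj L y + proj L (EuclideanSpace.single i s))
      = κ ((y i + s : ℝ) : AddCircle L) * ∏ j ∈ Finset.univ.erase i, κ (proj L y j) := by
    rw [tensorCube, ← Finset.mul_prod_erase _ _ (Finset.mem_univ i)]
    congr 1
    · simp [proj]
    · refine Finset.prod_congr rfl fun j hj => ?_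
      simp [proj, Finset.ne_of_mem_erase hj]
  have hderiv : HasDerivAt (fun s : ℝ => κ ((y i + s : ℝ) : AddCircle L)) (κ' (y i)) 0 :=
    HasDerivAt.comp_const_add (y i) 0 (by simpa using hκ.hasDerivAt (y i + 0))
  simp only [pderiv, hslice]
  rw [(hderiv.mul_const _).deriv, ← Finset.mul_prod_erase _ _ (Finset.mem_univ i), if_pos rfl]
  congr 1
  refine Finset.prod_congr rfl fun j hj => ?_
  rw [if_neg (Finset.ne_of_mem_erase hj)]

lemma integral_pderiv_tensorCube (hκ : IsCircleMollifier ε A κ κ') (i : Fin 3) :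
    ∫ z, pderiv i (tensorCube κ) z = 0 := by
  simp only [hκ.pderiv_tensorCube]
  rw [integral_fintype_prod_volume_eq_prod
    (f := fun j (w : AddCircle L) => (if j = i then κ' else κ) w)]
  exact Finset.prod_eq_zero (Finset.mem_univ i) (by simp [hκ.integral_deriv])

lemma integral_abs_pderiv_tensorCube_le (hκ : IsCircleMollifier ε A κ κ') (i : Fin 3) :
    ∫ z, |pderiv i (tensorCube κ) z| ≤ A / ε := by
  simp only [hκ.pderiv_tensorCube, Finset.abs_prod]
  rw [integral_fintype_prod_volume_eq_prod
    (f := fun j (w : AddCircle L) => |(if j = i then κ' else κ) w|),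
    ← Finset.mul_prod_erase _ _ (Finset.mem_univ i), Finset.prod_eq_one, mul_one]
  · simpa using hκ.integral_abs_deriv_le
  · intro j hj
    simp [Finset.ne_of_mem_erase hj, abs_of_nonneg (hκ.nonneg _), hκ.integral_eq_one]

lemma integral_norm_torusGrad_tensorCube_le (hκ : IsCircleMollifier ε A κ κ') :
    ∫ z, ‖torusGrad (tensorCube κ) z‖ ≤ 3 * A / ε := by
  have hsmooth := hκ.isSmooth_tensorCube
  have hFi (i : Fin 3) : Integrable fun z => |pderiv i (tensorCube κ) z| :=
    integrable_of_continuous (hsmooth.pderiv i).continuous.abs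
  calc ∫ z, ‖torusGrad (tensorCube κ) z‖
      ≤ ∫ z, ∑ i, |pderiv i (tensorCube κ) z| :=
        integral_mono (integrable_of_continuous hsmooth.continuous_torusGrad).norm
          (integrable_finsetSum _ fun i _ => hFi i) fun z => norm_le_sum_abs _
    _ = ∑ i, ∫ z, |pderiv i (tensorCube κ) z| := integral_finsetSum _ fun i _ => hFi i
    _ ≤ ∑ _i : Fin 3, A / ε := Finset.sum_le_sum fun i _ => hκ.integral_abs_pderiv_tensorCube_le i
    _ = 3 * A / ε := by simp [mul_div_assoc]

lemma exists_proj_eq (hκ : IsCircleMollifier ε A κ κ') (hε : 0 < ε) {z : Torus L}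
    (hz : tensorCube κ z ≠ 0 ∨ torusGrad (tensorCube κ) z ≠ 0) :
    ∃ ℓ : E3, proj L ℓ = z ∧ ε ≤ ‖ℓ‖ ∧ ‖ℓ‖ ≤ 4 * ε := by
  have hne (j : Fin 3) : κ (z j) ≠ 0 ∨ κ' (z j) ≠ 0 := by
    rcases hz with hz | hz
    · exact .inl (Finset.prod_ne_zero_iff.1 hz j (Finset.mem_univ j))
    obtain ⟨i, hi⟩ : ∃ i, pderiv i (tensorCube κ) z ≠ 0 := by
      by_contra! hzero
      exact hz (PiLp.ext hzero)
    rw [hκ.pderiv_tensorCube] at hi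
    have hj := Finset.prod_ne_zero_iff.1 hi j (Finset.mem_univ j)
    split_ifs at hj
    exacts [.inr hj, .inl hj]
  choose y hy hyz using fun j => hκ.exists_mem_Icc (hne j)
  exact ⟨WithLp.toLp 2 y, funext hyz, norm_mem_Icc_of_forall_mem hε hy⟩

lemma isAnnularKernel_tensorCube (hκ : IsCircleMollifier ε A κ κ') (hε : 0 < ε) :
    IsAnnularKernel ε (3 * A) (tensorCube κ) where
  smooth := hκ.isSmooth_tensorCube
  nonneg z := Finset.prod_nonneg fun i _ => hκ.nonneg (z i)
  integral_eq_one := by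
    simp only [tensorCube]
    rw [integral_fintype_prod_volume_eq_prod (f := fun _ => κ)]
    simp [hκ.integral_eq_one]
  integral_grad := by
    ext i
    have hcoord := (EuclideanSpace.proj (𝕜 := ℝ) i).integral_comp_comm
      (integrable_of_continuous hκ.isSmooth_tensorCube.continuous_torusGrad)
    exact hcoord.symm.trans (hκ.integral_pderiv_tensorCube i)
  integral_norm_grad_le := hκ.integral_norm_torusGrad_tensorCube_le
  exists_proj_eq := hκ.exists_proj_eq hε

end IsCircleMollifier

lemma exists_isAnnularKernel : ∃ A : ℝ, 0 ≤ A ∧ ∀ L [Fact (0 < L)] ε, 0 < ε → 2 * ε < L →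
    ∃ K : Torus L → ℝ, IsAnnularKernel ε A K := by
  obtain ⟨A, hA, H⟩ := exists_isCircleMollifier
  refine ⟨3 * A, by positivity, fun L _ ε hε hεL => ?_⟩
  obtain ⟨κ, κ', hκ⟩ := H L ε hε hεL
  exact ⟨tensorCube κ, hκ.isAnnularKernel_tensorCube hε⟩

end Kernel

section Lintegral

variable {X Y Z : Type*} [MeasurableSpace X] [MeasurableSpace Y] [MeasurableSpace Z]
  {μ : Measure X} {ν : Measure Y} {τ : Measure Z}

lemma enorm_le_enorm_mul_of_norm_le {E F G : Type*} [SeminormedAddCommGroup E]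
    [SeminormedAddCommGroup F] [SeminormedAddCommGroup G] {u : E} {v : F} {w : G}
    (h : ‖u‖ ≤ ‖v‖ * ‖w‖) : ‖u‖ₑ ≤ ‖v‖ₑ * ‖w‖ₑ := by
  simpa only [← ofReal_norm, ← ENNReal.ofReal_mul (norm_nonneg _)] using ENNReal.ofReal_le_ofReal h

lemma lintegral_enorm_mul_le_eLpNorm {E F : Type*} [NormedAddCommGroup E] [NormedAddCommGroup F]
    {f : X → E} {g : X → F} {p q : ℝ≥0∞} [ENNReal.HolderTriple p q 1]
    (hf : AEStronglyMeasurable f μ) (hg : AEStronglyMeasurable g μ) :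
    ∫⁻ x, ‖f x‖ₑ * ‖g x‖ₑ ∂μ ≤ eLpNorm f p μ * eLpNorm g q μ := by
  have h := eLpNorm_smul_le_mul_eLpNorm (p := p) (q := q) (r := 1) hg.norm hf.norm
  simpa only [eLpNorm_one_eq_lintegral_enorm, Pi.smul_apply', enorm_smul, enorm_norm, eLpNorm_norm]
    using h

lemma eLpNorm_two_sq {E : Type*} [NormedAddCommGroup E] (f : X → E) :
    eLpNorm f 2 μ ^ 2 = ∫⁻ x, ‖f x‖ₑ * ‖f x‖ₑ ∂μ := by
  rw [eLpNorm_eq_lintegral_rpow_enorm_toReal (by simp) (by simp), ← ENNReal.rpow_natCast,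
    ← ENNReal.rpow_mul]
  simp [pow_two]

lemma integral_norm_sq_eq {E : Type*} [NormedAddCommGroup E] {f : X → E}
    (hf : AEStronglyMeasurable f μ) : ∫ x, ‖f x‖ ^ 2 ∂μ = (eLpNorm f 2 μ).toReal ^ 2 := by
  rw [integral_eq_lintegral_of_nonneg_ae (ae_of_all _ fun x => sq_nonneg _) (hf.norm.pow 2),
    ← ENNReal.toReal_pow, eLpNorm_two_sq]
  simp only [pow_two, ENNReal.ofReal_mul (norm_nonneg _), ofReal_norm]

lemma lintegral_enorm_mul_mul_le_eLpNorm {E F G : Type*} [NormedAddCommGroup E]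
    [NormedAddCommGroup F] [NormedAddCommGroup G] {f : X → E} {g : X → F} {h : X → G}
    {p q : ℝ≥0∞} (hpq : p⁻¹ + 2 * q⁻¹ = 1) (hf : AEStronglyMeasurable f μ)
    (hg : AEStronglyMeasurable g μ) (hh : AEStronglyMeasurable h μ) :
    ∫⁻ x, ‖f x‖ₑ * (‖g x‖ₑ * ‖h x‖ₑ) ∂μ ≤ eLpNorm f p μ * (eLpNorm g q μ * eLpNorm h q μ) := by
  obtain ⟨s, hs⟩ : ∃ s : ℝ≥0∞, s⁻¹ = 2 * q⁻¹ := ⟨(2 * q⁻¹)⁻¹, inv_inv _⟩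
  have : ENNReal.HolderTriple q q s := ⟨by rw [hs, two_mul]⟩
  have : ENNReal.HolderTriple p s 1 := ⟨by rw [hs, hpq, inv_one]⟩
  have hgh := eLpNorm_smul_le_mul_eLpNorm (p := q) (q := q) (r := s) hh.norm hg.norm
  have hfgh := eLpNorm_smul_le_mul_eLpNorm (p := p) (q := s) (r := 1) (hg.norm.smul hh.norm) hf.norm
  simp only [eLpNorm_norm] at hgh hfgh
  calc ∫⁻ x, ‖f x‖ₑ * (‖g x‖ₑ * ‖h x‖ₑ) ∂μ
      = eLpNorm ((fun x => ‖f x‖) • (fun x => ‖g x‖) • fun x => ‖h x‖) 1 μ := by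
        simp only [eLpNorm_one_eq_lintegral_enorm, Pi.smul_apply', enorm_smul, enorm_norm]
    _ ≤ eLpNorm f p μ * (eLpNorm g q μ * eLpNorm h q μ) := hfgh.trans (mul_le_mul_right hgh _)

variable [SFinite μ] [SFinite ν] [SFinite τ]

lemma aemeasurable_mul_prod {p : X → Y → ℝ≥0∞} {q : X → Z → ℝ≥0∞}
    (hp : AEMeasurable (Function.uncurry p) (μ.prod ν))
    (hq : AEMeasurable (Function.uncurry q) (μ.prod τ)) :
    AEMeasurable (fun w : X × Y × Z => p w.1 w.2.1 * q w.1 w.2.2) (μ.prod (ν.prod τ)) := by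
  have hfst := QuasiMeasurePreserving.prodMap (.id μ)
    (Measure.quasiMeasurePreserving_fst (μ := ν) (ν := τ))
  have hsnd := QuasiMeasurePreserving.prodMap (.id μ)
    (Measure.quasiMeasurePreserving_snd (μ := ν) (ν := τ))
  exact (hp.comp_quasiMeasurePreserving hfst).mul (hq.comp_quasiMeasurePreserving hsnd)

omit [SFinite μ] in
lemma ae_lintegral_mul_lintegral {p : X → Y → ℝ≥0∞} {q : X → Z → ℝ≥0∞}
    (hp : AEMeasurable (Function.uncurry p) (μ.prod ν))
    (hq : AEMeasurable (Function.uncurry q) (μ.prod τ)) :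
    ∀ᵐ x ∂μ, (∫⁻ y, p x y ∂ν) * (∫⁻ z, q x z ∂τ) = ∫⁻ w, p x w.1 * q x w.2 ∂(ν.prod τ) := by
  filter_upwards [hp.aestronglyMeasurable.prodMk_left, hq.aestronglyMeasurable.prodMk_left]
    with x hpx hqx
  exact (lintegral_prod_mul hpx.aemeasurable hqx.aemeasurable).symm

lemma lintegral_mul_le_of_forall_le {k : Y → ℝ≥0∞} {g : Z → ℝ≥0∞} {p : X → Y → ℝ≥0∞}
    {q : X → Z → ℝ≥0∞} (hk : AEMeasurable k ν) (hg : AEMeasurable g τ)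
    (hp : AEMeasurable (Function.uncurry p) (μ.prod ν))
    (hq : AEMeasurable (Function.uncurry q) (μ.prod τ)) {c : ℝ≥0∞}
    (h : ∀ y z, k y ≠ 0 → g z ≠ 0 → ∫⁻ x, p x y * q x z ∂μ ≤ c) :
    ∫⁻ x, (∫⁻ y, k y * p x y ∂ν) * (∫⁻ z, g z * q x z ∂τ) ∂μ
      ≤ (∫⁻ y, k y ∂ν) * ((∫⁻ z, g z ∂τ) * c) := by
  have hkp : AEMeasurable (Function.uncurry fun x y => k y * p x y) (μ.prod ν) :=
    hk.comp_snd.mul hp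
  have hgq : AEMeasurable (Function.uncurry fun x z => g z * q x z) (μ.prod τ) :=
    hg.comp_snd.mul hq
  calc ∫⁻ x, (∫⁻ y, k y * p x y ∂ν) * (∫⁻ z, g z * q x z ∂τ) ∂μ
      = ∫⁻ x, ∫⁻ w, k w.1 * p x w.1 * (g w.2 * q x w.2) ∂(ν.prod τ) ∂μ :=
        lintegral_congr_ae (ae_lintegral_mul_lintegral hkp hgq)
    _ = ∫⁻ w, ∫⁻ x, k w.1 * p x w.1 * (g w.2 * q x w.2) ∂μ ∂(ν.prod τ) :=
        lintegral_lintegral_swap (aemeasurable_mul_prod hkp hgq)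
    _ ≤ ∫⁻ w, k w.1 * (g w.2 * c) ∂(ν.prod τ) := by
        refine lintegral_mono_ae ?_
        filter_upwards [(aemeasurable_mul_prod hp hq).prod_swap.aestronglyMeasurable.prodMk_left]
          with w hw
        simp only [mul_mul_mul_comm (k w.1), ← mul_assoc (k w.1)]
        refine (lintegral_const_mul'' _ hw.aemeasurable).trans_le ?_
        obtain hy | hy := eq_or_ne (k w.1) 0
        · simp [hy]
        obtain hz | hz := eq_or_ne (g w.2) 0
        · simp [hz]
        · exact mul_le_mul_right (h w.1 w.2 hy hz) _
    _ = (∫⁻ y, k y ∂ν) * ((∫⁻ z, g z ∂τ) * c) := by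
        rw [lintegral_prod_mul hk (hg.mul_const c), lintegral_mul_const'' _ hg]

omit [SFinite τ] in
lemma eLpNorm_two_le_of_enorm_le_lintegral {E F : Type*} [NormedAddCommGroup E]
    [NormedAddCommGroup F] {k : Y → ℝ≥0∞} {p : X → Y → E} {f : X → F}
    (hk : AEMeasurable k ν) (hone : ∫⁻ y, k y ∂ν = 1)
    (hp : AEStronglyMeasurable (Function.uncurry p) (μ.prod ν))
    (hpy : ∀ y, AEStronglyMeasurable (fun x => p x y) μ)
    (hf : ∀ x, ‖f x‖ₑ ≤ ∫⁻ y, k y * ‖p x y‖ₑ ∂ν) {D : ℝ≥0∞}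
    (hD : ∀ y, k y ≠ 0 → eLpNorm (fun x => p x y) 2 μ ≤ D) : eLpNorm f 2 μ ≤ D := by
  rw [← ENNReal.pow_le_pow_left_iff two_ne_zero, eLpNorm_two_sq]
  calc ∫⁻ x, ‖f x‖ₑ * ‖f x‖ₑ ∂μ
      ≤ ∫⁻ x, (∫⁻ y, k y * ‖p x y‖ₑ ∂ν) * (∫⁻ y, k y * ‖p x y‖ₑ ∂ν) ∂μ :=
        lintegral_mono fun x => mul_le_mul' (hf x) (hf x)
    _ ≤ (∫⁻ y, k y ∂ν) * ((∫⁻ y, k y ∂ν) * (D * D)) :=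
        lintegral_mul_le_of_forall_le hk hk hp.enorm hp.enorm fun y z hy hz =>
          (lintegral_enorm_mul_le_eLpNorm (p := 2) (q := 2) (hpy y) (hpy z)).trans
            (mul_le_mul' (hD y hy) (hD z hz))
    _ = D ^ 2 := by rw [hone, one_mul, one_mul, pow_two]

lemma lintegral_add_mul_le_of_forall_le {k : Y → ℝ≥0∞} {g : Z → ℝ≥0∞} {p q : X → Y → ℝ≥0∞}
    {r : X → Z → ℝ≥0∞} (hk : AEMeasurable k ν) (hg : AEMeasurable g τ)
    (hp : AEMeasurable (Function.uncurry p) (μ.prod ν))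
    (hq : AEMeasurable (Function.uncurry q) (μ.prod ν))
    (hr : AEMeasurable (Function.uncurry r) (μ.prod τ)) (hone : ∫⁻ y, k y ∂ν = 1) {c : ℝ≥0∞}
    (h : ∀ y y' z, k y ≠ 0 → k y' ≠ 0 → g z ≠ 0 → ∫⁻ x, p x y * (q x y' * r x z) ∂μ ≤ c) :
    ∫⁻ x, ((∫⁻ y, k y * (p x y * q x y) ∂ν)
        + (∫⁻ y, k y * p x y ∂ν) * ∫⁻ y, k y * q x y ∂ν) * (∫⁻ z, g z * r x z ∂τ) ∂μ
      ≤ 2 * ((∫⁻ z, g z ∂τ) * c) := by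
  have hmeas : AEMeasurable (fun x => (∫⁻ y, k y * (p x y * q x y) ∂ν) * ∫⁻ z, g z * r x z ∂τ) μ :=
    (hk.comp_snd.mul (hp.mul hq)).lintegral_prod_right'.mul
      (hg.comp_snd.mul hr).lintegral_prod_right'
  have hdiag := lintegral_mul_le_of_forall_le (p := fun x y => p x y * q x y) hk hg
    (hp.mul hq) hr (c := c)
    fun y z hy hz => by simpa only [mul_assoc] using h y y z hy hy hz
  have hpair := lintegral_mul_le_of_forall_le (k := fun w : Y × Y => k w.1 * k w.2)
    (p := fun x w => p x w.1 * q x w.2) (hk.comp_fst.mul hk.comp_snd) hg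
    (aemeasurable_mul_prod hp hq) hr (c := c) fun y z hy hz => by
      simpa only [mul_assoc] using
        h y.1 y.2 z (left_ne_zero_of_mul hy) (right_ne_zero_of_mul hy) hz
  have hprod : ∀ᵐ x ∂μ, (∫⁻ y, k y * p x y ∂ν) * (∫⁻ y, k y * q x y ∂ν)
      = ∫⁻ w, k w.1 * k w.2 * (p x w.1 * q x w.2) ∂(ν.prod ν) := by
    simpa only [mul_mul_mul_comm] using
      ae_lintegral_mul_lintegral (p := fun x y => k y * p x y) (q := fun x y => k y * q x y)
        (hk.comp_snd.mul hp) (hk.comp_snd.mul hq)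
  have hone' : ∫⁻ w : Y × Y, k w.1 * k w.2 ∂(ν.prod ν) = 1 := by
    rw [lintegral_prod_mul hk hk, hone, one_mul]
  simp only [hone, hone', one_mul] at hdiag hpair
  simp only [add_mul]
  rw [lintegral_add_left' hmeas, two_mul]
  refine add_le_add hdiag (le_of_eq_of_le (lintegral_congr_ae ?_) hpair)
  filter_upwards [hprod] with x hx
  rw [hx]

end Lintegral

section Average

variable {L : ℝ} [Fact (0 < L)] {E F : Type*} [NormedAddCommGroup E] [NormedSpace ℝ E]
  [NormedAddCommGroup F] [NormedSpace ℝ F]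

/-- The average `∫ M(z) f(x + z) dz` of the translates of `f` with an operator-valued kernel `M`. -/
def average (M : Torus L → E →L[ℝ] F) (f : Torus L → E) (x : Torus L) : F :=
  ∫ z, M z (f (x + z))

lemma average_eq_integral_sub (M : Torus L → E →L[ℝ] F) (f : Torus L → E) (x : Torus L) :
    average M f x = ∫ y, M (y - x) (f y) := by
  rw [← integral_add_left_eq_self (μ := volume) (fun y => M (y - x) (f y)) x]
  simp only [average, add_sub_cancel_left]

lemma integrable_kernel_apply {M : Torus L → E →L[ℝ] F} (hM : Continuous M) {f : Torus L → E}
    (hf : Integrable f) : Integrable (fun z => M z (f z)) := by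
  obtain ⟨C, hC⟩ := exists_bound_of_continuous hM
  exact Integrable.mono' (hf.norm.const_mul C)
    (ContinuousLinearMap.aestronglyMeasurable_comp₂ (.id ℝ _) hM.aestronglyMeasurable
      hf.aestronglyMeasurable)
    (ae_of_all _ fun z => (M z).le_of_opNorm_le (hC z) _)

lemma integrable_average_integrand {M : Torus L → E →L[ℝ] F} (hM : Continuous M)
    {f : Torus L → E} (hf : Integrable f) (x : Torus L) :
    Integrable (fun z => M z (f (x + z))) :=
  integrable_kernel_apply hM (hf.comp_add_left x)

lemma norm_average_le {M : Torus L → E →L[ℝ] F} {C : ℝ} (hC : ∀ z, ‖M z‖ ≤ C)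
    {f : Torus L → E} (hf : Integrable f) (x : Torus L) :
    ‖average M f x‖ ≤ C * ∫ z, ‖f z‖ := by
  rw [← integral_add_left_eq_self (μ := volume) (fun y => ‖f y‖) x, ← integral_const_mul]
  exact norm_integral_le_of_norm_le ((hf.comp_add_left x).norm.const_mul C)
    (ae_of_all _ fun z => (M z).le_of_opNorm_le (hC z) _)

lemma continuous_average {M : Torus L → E →L[ℝ] F} (hM : Continuous M) {f : Torus L → E}
    (hf : Integrable f) : Continuous (average M f) := by
  obtain ⟨C, hC⟩ := exists_bound_of_continuous hM
  simp only [funext (average_eq_integral_sub M f)]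
  refine continuous_of_dominated (bound := fun y => C * ‖f y‖) (fun x => ?_)
    (fun x => ae_of_all _ fun y => (M _).le_of_opNorm_le (hC _) _) (hf.norm.const_mul C)
    (ae_of_all _ fun y => (hM.comp (continuous_const.sub continuous_id)).clm_apply
      continuous_const)
  exact (integrable_kernel_apply (hM.comp (continuous_id.sub continuous_const)) hf).1

lemma aestronglyMeasurable_average {S : Type*} [MeasurableSpace S] {ν : Measure S} [SFinite ν]
    {M : Torus L → E →L[ℝ] F} (hM : Continuous M) {f : S → Torus L → E}
    (hf : AEStronglyMeasurable (Function.uncurry f) (ν.prod volume)) :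
    AEStronglyMeasurable (fun p : S × Torus L => average M (f p.1) p.2) (ν.prod volume) := by
  have hadd : Measure.QuasiMeasurePreserving (fun w : Torus L × Torus L => w.1 + w.2) :=
    Measure.quasiMeasurePreserving_snd.comp
      (measurePreserving_prod_add volume volume).quasiMeasurePreserving
  have hshift := (QuasiMeasurePreserving.prodMap (.id ν) hadd).comp
    (measurePreserving_prodAssoc ν volume volume).quasiMeasurePreserving
  exact (ContinuousLinearMap.aestronglyMeasurable_comp₂ (.id ℝ _)
    hM.aestronglyMeasurable.comp_snd
    (hf.comp_quasiMeasurePreserving hshift)).integral_prod_right'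

end Average

section Pairing

variable {L : ℝ} [Fact (0 < L)] {E F : Type*} [NormedAddCommGroup E] [NormedSpace ℝ E]
  [NormedAddCommGroup F] [InnerProductSpace ℝ F] [CompleteSpace F]

omit [CompleteSpace F] in
lemma integrable_inner_kernel {M : Torus L → E →L[ℝ] F} (hM : Continuous M) {V : Torus L → F}
    (hV : Continuous V) {f : Torus L → E} (hf : Integrable f) :
    Integrable (fun p : Torus L × Torus L => inner ℝ (V p.1) (M (p.2 - p.1) (f p.2)))
      (volume.prod volume) := by
  obtain ⟨C, hC⟩ := exists_bound_of_continuous hV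
  obtain ⟨D, hD⟩ := exists_bound_of_continuous hM
  have hsnd : Integrable (fun p : Torus L × Torus L => f p.2) (volume.prod volume) := hf.comp_snd _
  have hM' : Continuous fun p : Torus L × Torus L => M (p.2 - p.1) :=
    hM.comp (continuous_snd.sub continuous_fst)
  refine Integrable.mono' (hsnd.norm.const_mul (C * D)) ?_ (ae_of_all _ fun p => ?_)
  · exact (hV.comp continuous_fst).aestronglyMeasurable.inner
      (ContinuousLinearMap.aestronglyMeasurable_comp₂ (.id ℝ _) hM'.aestronglyMeasurable hsnd.1)
  · calc ‖inner ℝ (V p.1) (M (p.2 - p.1) (f p.2))‖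
        ≤ ‖V p.1‖ * ‖M (p.2 - p.1) (f p.2)‖ := norm_inner_le_norm _ _
      _ ≤ C * (D * ‖f p.2‖) := mul_le_mul (hC _) ((M _).le_of_opNorm_le (hD _) _)
          (norm_nonneg _) ((norm_nonneg _).trans (hC p.1))
      _ = C * D * ‖f p.2‖ := (mul_assoc _ _ _).symm

lemma integral_inner_average {M : Torus L → E →L[ℝ] F} (hM : Continuous M) {V : Torus L → F}
    (hV : Continuous V) {f : Torus L → E} (hf : Integrable f) :
    ∫ x, inner ℝ (V x) (average M f x) = ∫ y, ∫ x, inner ℝ (V x) (M (y - x) (f y)) := by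
  rw [← integral_integral_swap (integrable_inner_kernel hM hV hf)]
  refine integral_congr_ae (ae_of_all _ fun x => ?_)
  simp only [average_eq_integral_sub]
  exact (integral_inner (integrable_kernel_apply (hM.comp (continuous_sub_right x)) hf) _).symm

lemma integral_inner_average_eq_integral_translate {M : Torus L → E →L[ℝ] F} (hM : Continuous M)
    {V : Torus L → F} (hV : Continuous V) {f : Torus L → E} (hf : Integrable f) :
    ∫ x, inner ℝ (V x) (average M f x) = ∫ w, ∫ x, inner ℝ (V x) (M w (f (x + w))) := by
  have hFi := (measurePreserving_prod_add (volume : Measure (Torus L))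
    (volume : Measure (Torus L))).integrable_comp_of_integrable (integrable_inner_kernel hM hV hf)
  simp only [Function.comp_def, add_sub_cancel_left] at hFi
  rw [← integral_integral_swap hFi]
  refine integral_congr_ae (ae_of_all _ fun x => ?_)
  exact (integral_inner (integrable_average_integrand hM hf x) _).symm

end Pairing

section Curl

variable {L : ℝ} {E : Type*} [NormedAddCommGroup E] [NormedSpace ℝ E]

/-- The kernel of the mollification by `K`. -/
def mollKernel (K : Torus L → ℝ) (z : Torus L) : E →L[ℝ] E :=
  K z • ContinuousLinearMap.id ℝ E

/-- The kernel of the curl of the mollification by `K`. -/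
def curlKernel (K : Torus L → ℝ) (z : Torus L) : E3 →L[ℝ] E3 :=
  crossL.flip (torusGrad K z)

@[simp] lemma mollKernel_apply (K : Torus L → ℝ) (z : Torus L) (v : E) :
    mollKernel K z v = K z • v := rfl

@[simp] lemma curlKernel_apply (K : Torus L → ℝ) (z : Torus L) (v : E3) :
    curlKernel K z v = cross v (torusGrad K z) := rfl

lemma continuous_mollKernel {K : Torus L → ℝ} (hK : Continuous K) :
    Continuous (mollKernel (E := E) K) :=
  hK.smul continuous_const

lemma continuous_curlKernel {K : Torus L → ℝ} (hK : IsSmooth K) : Continuous (curlKernel K) :=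
  crossL.flip.continuous.comp hK.continuous_torusGrad

lemma curl_comp_sub_right (φ : Torus L → E3) (x y : Torus L) :
    curl (fun y => φ (y - x)) y = curl φ (y - x) := by
  have hd (i k : Fin 3) :
      pderiv i (fun y => φ (y - x) k) y = pderiv i (fun y => φ y k) (y - x) :=
    pderiv_comp_sub_right (fun y => φ y k) i x y
  simp only [curl, hd]

lemma IsSmooth.continuous_curl {φ : Torus L → E3} (hφ : IsSmooth φ) : Continuous (curl φ) := by
  have hd (i k : Fin 3) : Continuous (EMHD.pderiv i fun y => φ y k) := by
    have hk : IsSmooth fun y => φ y k := (EuclideanSpace.proj (𝕜 := ℝ) k).contDiff.comp hφ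
    exact (hk.pderiv i).continuous
  refine (PiLp.continuous_toLp 2 _).comp (continuous_pi fun i => ?_)
  fin_cases i <;> exact (hd _ _).sub (hd _ _)

variable [Fact (0 < L)]

namespace IsWeakCurl

lemma average_curlKernel {U J : Torus L → E3} (h : IsWeakCurl U J) (hU : Integrable U)
    (hJ : Integrable J) {K : Torus L → ℝ} (hK : IsSmooth K) (x : Torus L) :
    average (curlKernel K) U x = average (mollKernel K) J x := by
  refine ext_inner_right ℝ fun e => ?_
  have hx := continuous_sub_right x
  have hJx := integrable_kernel_apply ((continuous_mollKernel hK.continuous).comp hx) hJ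
  have hUx := integrable_kernel_apply ((continuous_curlKernel hK).comp hx) hU
  have htest := h _ ((hK.comp_sub_right x).smul_const e)
  simp only [curl_smul_const, torusGrad_comp_sub_right, inner_cross_cyclic] at htest
  simp only [real_inner_comm e, average_eq_integral_sub]
  refine (integral_inner hUx e).symm.trans (Eq.trans ?_ (integral_inner hJx e))
  simpa only [Function.comp_apply, mollKernel_apply, curlKernel_apply, inner_smul_right,
    real_inner_comm e] using htest.symm

lemma average {U J : Torus L → E3} (h : IsWeakCurl U J) (hU : Integrable U) (hJ : Integrable J)
    {K : Torus L → ℝ} (hK : Continuous K) :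
    IsWeakCurl (average (mollKernel K) U) (average (mollKernel K) J) := by
  intro φ hφ
  have hM : Continuous (mollKernel (E := E3) K) := continuous_mollKernel hK
  simp only [real_inner_comm _ (EMHD.average _ _ _)]
  rw [integral_inner_average_eq_integral_translate hM hφ.continuous hJ,
    integral_inner_average_eq_integral_translate hM hφ.continuous_curl hU]
  refine integral_congr_ae (ae_of_all _ fun w => ?_)
  have htest := h _ (hφ.comp_sub_right w)
  simp only [curl_comp_sub_right] at htest
  rw [← integral_add_right_eq_self _ w, ← integral_add_right_eq_self (fun x => inner ℝ (U x) _) w]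
    at htest
  simp only [add_sub_cancel_right] at htest
  simp only [mollKernel_apply, inner_smul_right, integral_const_mul, real_inner_comm (J _),
    real_inner_comm (U _), htest]

lemma integral_inner_average_curlKernel {V W f : Torus L → E3} (h : IsWeakCurl V W)
    (hV : Continuous V) (hW : Continuous W) (hf : Integrable f) {K : Torus L → ℝ}
    (hK : IsSmooth K) :
    ∫ x, inner ℝ (V x) (EMHD.average (curlKernel K) f x)
      = ∫ x, inner ℝ (W x) (EMHD.average (mollKernel K) f x) := by
  rw [integral_inner_average (continuous_curlKernel hK) hV hf,
    integral_inner_average (continuous_mollKernel hK.continuous) hW hf]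
  refine integral_congr_ae (ae_of_all _ fun y => ?_)
  have htest := h _ ((hK.comp_const_sub y).smul_const (f y))
  simp only [curl_smul_const, torusGrad_comp_const_sub] at htest
  have hanti (u v : E3) : cross (-u) v = cross v u := by
    ext i; fin_cases i <;> simp [cross] <;> ring
  simpa only [hanti, mollKernel_apply, curlKernel_apply] using htest.symm

end IsWeakCurl

end Curl

section Mollification

variable {L : ℝ} [Fact (0 < L)]

lemma aestronglyMeasurable_translate_sub {E : Type*} [NormedAddCommGroup E] {f : Torus L → E}
    (hf : AEStronglyMeasurable f) :
    AEStronglyMeasurable (fun p : Torus L × Torus L => f (p.1 + p.2) - f p.1)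
      (volume.prod volume) :=
  (hf.comp_snd.comp_measurePreserving (measurePreserving_prod_add volume volume)).sub hf.comp_fst

lemma aestronglyMeasurable_comp_add_right {E : Type*} [NormedAddCommGroup E] {f : Torus L → E}
    (hf : AEStronglyMeasurable f) (z : Torus L) : AEStronglyMeasurable fun x => f (x + z) :=
  hf.comp_measurePreserving (measurePreserving_add_right volume z)

variable {E F G : Type*} [NormedAddCommGroup E] [NormedSpace ℝ E] [NormedAddCommGroup F]
  [NormedSpace ℝ F] [NormedAddCommGroup G] [NormedSpace ℝ G]

lemma average_mollKernel_sub [CompleteSpace E] {K : Torus L → ℝ} (hK : Continuous K)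
    (hone : ∫ z, K z = 1) {f : Torus L → E} (hf : Integrable f) (x : Torus L) :
    average (mollKernel K) f x - f x = ∫ z, K z • (f (x + z) - f x) := by
  have hfx := integrable_average_integrand (continuous_mollKernel hK) hf x
  simp only [mollKernel_apply] at hfx
  simp only [smul_sub]
  rw [integral_sub hfx ((integrable_of_continuous hK).smul_const _), integral_smul_const, hone,
    one_smul]
  rfl

lemma enorm_average_mollKernel_sub_le [CompleteSpace E] {K : Torus L → ℝ} (hK : Continuous K)
    (hone : ∫ z, K z = 1) {f : Torus L → E} (hf : Integrable f) (x : Torus L) :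
    ‖average (mollKernel K) f x - f x‖ₑ ≤ ∫⁻ z, ‖K z‖ₑ * ‖f (x + z) - f x‖ₑ := by
  rw [average_mollKernel_sub hK hone hf]
  simpa only [enorm_smul] using
    enorm_integral_le_lintegral_enorm fun z => K z • (f (x + z) - f x)

lemma average_curlKernel_eq {K : Torus L → ℝ} (hK : IsSmooth K) (hzero : ∫ z, torusGrad K z = 0)
    {f : Torus L → E3} (hf : Integrable f) (x : Torus L) :
    average (curlKernel K) f x = ∫ z, cross (f (x + z) - f x) (torusGrad K z) := by
  have hfx := integrable_average_integrand (continuous_curlKernel hK) hf x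
  have hgrad := integrable_of_continuous hK.continuous_torusGrad
  simp only [curlKernel_apply, ← crossL_apply] at hfx
  simp only [← crossL_apply, map_sub, _root_.sub_apply]
  rw [integral_sub hfx ((crossL (f x)).integrable_comp hgrad),
    ContinuousLinearMap.integral_comp_comm _ hgrad, hzero, map_zero, sub_zero]
  rfl

lemma enorm_average_curlKernel_le {K : Torus L → ℝ} (hK : IsSmooth K)
    (hzero : ∫ z, torusGrad K z = 0) {f : Torus L → E3} (hf : Integrable f) (x : Torus L) :
    ‖average (curlKernel K) f x‖ₑ ≤ ∫⁻ z, ‖torusGrad K z‖ₑ * ‖f (x + z) - f x‖ₑ := by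
  rw [average_curlKernel_eq hK hzero hf]
  refine (enorm_integral_le_lintegral_enorm _).trans (lintegral_mono fun z => ?_)
  rw [mul_comm]
  exact enorm_le_enorm_mul_of_norm_le (norm_cross_le _ _)

lemma average_mollKernel_clm_comp [CompleteSpace E] [CompleteSpace F] (T : E →L[ℝ] F)
    {K : Torus L → ℝ} (hK : Continuous K) {f : Torus L → E} (hf : Integrable f) (x : Torus L) :
    average (mollKernel K) (fun y => T (f y)) x = T (average (mollKernel K) f x) := by
  simp only [average, mollKernel_apply, ← map_smul]
  exact T.integral_comp_comm (integrable_average_integrand (continuous_mollKernel hK) hf x)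

/-- The Constantin–E–Titi commutator identity for a bilinear map. -/
lemma average_mollKernel_bilin_sub [CompleteSpace E] [CompleteSpace F] [CompleteSpace G]
    (B : E →L[ℝ] F →L[ℝ] G) {K : Torus L → ℝ} (hK : Continuous K) (hone : ∫ z, K z = 1)
    {f : Torus L → E} {g : Torus L → F} (hf : Integrable f) (hg : Integrable g)
    (hfg : Integrable fun x => B (f x) (g x)) (x : Torus L) :
    average (mollKernel K) (fun x => B (f x) (g x)) x
        - B (average (mollKernel K) f x) (average (mollKernel K) g x)
      = (∫ z, K z • B (f (x + z) - f x) (g (x + z) - g x))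
        - B (average (mollKernel K) f x - f x) (average (mollKernel K) g x - g x) := by
  have hBf : Integrable fun z => K z • B.flip (g x) (f (x + z)) :=
    integrable_average_integrand (continuous_mollKernel hK) ((B.flip (g x)).integrable_comp hf) x
  have hBg : Integrable fun z => K z • B (f x) (g (x + z)) :=
    integrable_average_integrand (continuous_mollKernel hK) ((B (f x)).integrable_comp hg) x
  have hB : Integrable fun z => K z • B (f (x + z)) (g (x + z)) :=
    integrable_average_integrand (continuous_mollKernel hK) hfg x
  have hexpand (z : Torus L) : K z • B (f (x + z) - f x) (g (x + z) - g x)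
      = K z • B (f (x + z)) (g (x + z)) - K z • B.flip (g x) (f (x + z))
        - K z • B (f x) (g (x + z)) + K z • B (f x) (g x) := by
    simp only [map_sub, _root_.sub_apply, smul_sub, ContinuousLinearMap.flip_apply]
    abel
  have hmean : ∫ z, K z • B (f (x + z) - f x) (g (x + z) - g x)
      = average (mollKernel K) (fun x => B (f x) (g x)) x
        - B.flip (g x) (average (mollKernel K) f x) - B (f x) (average (mollKernel K) g x)
        + B (f x) (g x) := by
    simp only [hexpand]
    refine (integral_add ((hB.sub hBf).sub hBg)
      ((integrable_of_continuous hK).smul_const _)).trans ?_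
    rw [integral_sub' (hB.sub hBf) hBg, integral_sub' hB hBf, integral_smul_const, hone, one_smul,
      ← average_mollKernel_clm_comp (B.flip (g x)) hK hf,
      ← average_mollKernel_clm_comp (B (f x)) hK hg]
    rfl
  rw [hmean]
  simp only [map_sub, _root_.sub_apply, ContinuousLinearMap.flip_apply]
  abel

end Mollification

namespace IsAnnularKernel

variable {L : ℝ} [Fact (0 < L)] {ε A : ℝ} {K : Torus L → ℝ}

lemma lintegral_enorm (hK : IsAnnularKernel ε A K) : ∫⁻ z, ‖K z‖ₑ = 1 := by
  rw [← ofReal_integral_norm_eq_lintegral_enorm (integrable_of_continuous hK.smooth.continuous)]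
  simp only [Real.norm_of_nonneg (hK.nonneg _), hK.integral_eq_one, ENNReal.ofReal_one]

lemma lintegral_enorm_torusGrad_le (hK : IsAnnularKernel ε A K) :
    ∫⁻ z, ‖torusGrad K z‖ₑ ≤ ENNReal.ofReal (A / ε) := by
  rw [← ofReal_integral_norm_eq_lintegral_enorm
    (integrable_of_continuous hK.smooth.continuous_torusGrad)]
  exact ENNReal.ofReal_le_ofReal hK.integral_norm_grad_le

end IsAnnularKernel

/-- The product of an `L^p` increment of `J` and two `L^q` increments of `U`, with shifts in the
annulus `ε ≤ |ℓ| ≤ 4ε`, is at most `c`. -/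
def IncrementBound {L : ℝ} [Fact (0 < L)] (p q : ℝ≥0∞) (J U : Torus L → E3) (ε : ℝ) (c : ℝ≥0∞) :
    Prop :=
  ∀ ℓ₀ ℓ₁ ℓ₂ : E3, ‖ℓ₀‖ ∈ Icc ε (4 * ε) → ‖ℓ₁‖ ∈ Icc ε (4 * ε) → ‖ℓ₂‖ ∈ Icc ε (4 * ε) →
    eLpNorm (incr J ℓ₀) p volume
      * (eLpNorm (incr U ℓ₁) q volume * eLpNorm (incr U ℓ₂) q volume) ≤ c

section Flux

/-- The rate at which the nonlinearity removes the energy `½ ∫ |U_ε|²` of the mollification `U_ε` of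
`U` by `K`. -/
def energyFlux {L : ℝ} [Fact (0 < L)] (K : Torus L → ℝ) (U J : Torus L → E3) : ℝ :=
  ∫ x, inner ℝ (average (mollKernel K) J x)
    (average (mollKernel K) (fun y => cross (J y) (U y)) x)

variable {L : ℝ} [Fact (0 < L)] {ε A : ℝ} {K : Torus L → ℝ}

lemma enorm_inner_average_cross_le (hK : IsAnnularKernel ε A K) {U J : Torus L → E3}
    (hcurl : IsWeakCurl U J) (hU : Integrable U) (hJ : Integrable J)
    (hF : Integrable fun x => cross (J x) (U x)) (x : Torus L) :
    ‖inner ℝ (average (mollKernel K) J x)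
        (average (mollKernel K) (fun x => cross (J x) (U x)) x)‖ₑ
      ≤ ((∫⁻ z, ‖K z‖ₑ * (‖J (x + z) - J x‖ₑ * ‖U (x + z) - U x‖ₑ))
        + (∫⁻ z, ‖K z‖ₑ * ‖J (x + z) - J x‖ₑ) * ∫⁻ z, ‖K z‖ₑ * ‖U (x + z) - U x‖ₑ)
        * ∫⁻ w, ‖torusGrad K w‖ₑ * ‖U (x + w) - U x‖ₑ := by
  have hKc := hK.smooth.continuous
  -- `(J_ε × U_ε) · J_ε = 0`, so only the commutator contributes to the flux
  have hcommutator : inner ℝ (average (mollKernel K) J x)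
      (average (mollKernel K) (fun x => cross (J x) (U x)) x)
      = inner ℝ (average (mollKernel K) (fun x => cross (J x) (U x)) x
        - cross (average (mollKernel K) J x) (average (mollKernel K) U x))
          (average (mollKernel K) J x) := by
    rw [inner_sub_left, inner_cross_self_left, sub_zero, real_inner_comm]
  rw [hcommutator]
  refine (enorm_le_enorm_mul_of_norm_le (norm_inner_le_norm _ _)).trans (mul_le_mul' ?_ ?_)
  · simp only [← crossL_apply]
    rw [average_mollKernel_bilin_sub crossL hKc hK.integral_eq_one hJ hU hF]
    refine enorm_sub_le.trans (add_le_add ?_ ?_)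
    · refine (enorm_integral_le_lintegral_enorm _).trans (lintegral_mono fun z => ?_)
      rw [enorm_smul]
      exact mul_le_mul' le_rfl (enorm_le_enorm_mul_of_norm_le (norm_cross_le _ _))
    · exact (enorm_le_enorm_mul_of_norm_le (norm_cross_le _ _)).trans
        (mul_le_mul' (enorm_average_mollKernel_sub_le hKc hK.integral_eq_one hJ x)
          (enorm_average_mollKernel_sub_le hKc hK.integral_eq_one hU x))
  · rw [← hcurl.average_curlKernel hU hJ hK.smooth]
    exact enorm_average_curlKernel_le hK.smooth hK.integral_grad hU x

lemma enorm_energyFlux_le {p q : ℝ≥0∞} (hpq : p⁻¹ + 2 * q⁻¹ = 1) (hK : IsAnnularKernel ε A K)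
    {U J : Torus L → E3} (hcurl : IsWeakCurl U J) (hU : Integrable U) (hJ : Integrable J)
    (hF : Integrable fun x => cross (J x) (U x)) {c : ℝ≥0∞} (hc : IncrementBound p q J U ε c) :
    ‖energyFlux K U J‖ₑ ≤ 2 * (ENNReal.ofReal (A / ε) * c) := by
  have hJz (z : Torus L) := (aestronglyMeasurable_comp_add_right hJ.1 z).sub hJ.1
  have hUz (z : Torus L) := (aestronglyMeasurable_comp_add_right hU.1 z).sub hU.1
  have htriple (y y' z : Torus L) (hy : ‖K y‖ₑ ≠ 0) (hy' : ‖K y'‖ₑ ≠ 0)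
      (hz : ‖torusGrad K z‖ₑ ≠ 0) :
      ∫⁻ x, ‖J (x + y) - J x‖ₑ * (‖U (x + y') - U x‖ₑ * ‖U (x + z) - U x‖ₑ) ≤ c := by
    obtain ⟨ℓ₀, rfl, h₀⟩ := hK.exists_proj_eq (.inl (enorm_ne_zero.1 hy))
    obtain ⟨ℓ₁, rfl, h₁⟩ := hK.exists_proj_eq (.inl (enorm_ne_zero.1 hy'))
    obtain ⟨ℓ₂, rfl, h₂⟩ := hK.exists_proj_eq (.inr (enorm_ne_zero.1 hz))
    exact (lintegral_enorm_mul_mul_le_eLpNorm hpq (hJz _) (hUz _) (hUz _)).trans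
      (hc ℓ₀ ℓ₁ ℓ₂ h₀ h₁ h₂)
  have hUm := (aestronglyMeasurable_translate_sub hU.1).enorm
  calc _ ≤ ∫⁻ x, ‖inner ℝ (average (mollKernel K) J x)
          (average (mollKernel K) (fun x => cross (J x) (U x)) x)‖ₑ :=
        enorm_integral_le_lintegral_enorm _
    _ ≤ 2 * ((∫⁻ w, ‖torusGrad K w‖ₑ) * c) :=
        (lintegral_mono fun x => enorm_inner_average_cross_le hK hcurl hU hJ hF x).trans
          (lintegral_add_mul_le_of_forall_le (p := fun x z => ‖J (x + z) - J x‖ₑ)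
            (q := fun x z => ‖U (x + z) - U x‖ₑ) (r := fun x z => ‖U (x + z) - U x‖ₑ)
            hK.smooth.continuous.aestronglyMeasurable.enorm
            hK.smooth.continuous_torusGrad.aestronglyMeasurable.enorm
            (aestronglyMeasurable_translate_sub hJ.1).enorm hUm hUm hK.lintegral_enorm htriple)
    _ ≤ 2 * (ENNReal.ofReal (A / ε) * c) := by
        gcongr
        exact hK.lintegral_enorm_torusGrad_le

end Flux

section Convergence

variable {L : ℝ} [Fact (0 < L)] {E : Type*} [NormedAddCommGroup E]

lemma tendsto_eLpNorm_translate_sub {p : ℝ≥0∞} [Fact (1 ≤ p)] [hp : Fact (p ≠ ⊤)]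
    {f : Torus L → E} (hf : MemLp f p) :
    Tendsto (fun z : Torus L => eLpNorm (fun x => f (x + z) - f x) p volume) (𝓝 0) (𝓝 0) := by
  have : ContinuousVAdd (Torus L)ᵈᵃᵃ (Lp E p (volume : Measure (Torus L))) :=
    Lp.instContinuousVAddDomAddAct
  have hcont : Continuous fun z : Torus L => DomAddAct.mk z +ᵥ hf.toLp f :=
    DomAddAct.continuous_mk.vadd continuous_const
  have hlim := (hcont.edist (continuous_const (y := hf.toLp f))).tendsto 0
  simp only [DomAddAct.mk_zero, zero_vadd, edist_self] at hlim
  refine hlim.congr fun z => ?_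
  rw [DomAddAct.mk_vadd_toLp, Lp.edist_toLp_toLp]
  simp only [vadd_eq_add, add_comm z]
  rfl

variable [NormedSpace ℝ E] {f : Torus L → E}

lemma eLpNorm_average_le {ε A : ℝ} {K : Torus L → ℝ} (hK : IsAnnularKernel ε A K)
    (hf : AEStronglyMeasurable f) :
    eLpNorm (average (mollKernel K) f) 2 volume ≤ eLpNorm f 2 volume := by
  refine eLpNorm_two_le_of_enorm_le_lintegral (k := fun z => ‖K z‖ₑ)
    (p := fun x z => f (x + z)) hK.smooth.continuous.aestronglyMeasurable.enorm hK.lintegral_enorm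
    (hf.comp_snd.comp_measurePreserving (measurePreserving_prod_add volume volume))
    (aestronglyMeasurable_comp_add_right hf) (fun x => ?_) fun z _ => ?_
  · exact (enorm_integral_le_lintegral_enorm _).trans_eq
      (by simp only [mollKernel_apply, enorm_smul])
  · exact (eLpNorm_comp_measurePreserving hf (measurePreserving_add_right volume z)).le

lemma memLp_average {K : Torus L → ℝ} (hK : Continuous K) (hf : Integrable f) (p : ℝ≥0∞) :
    MemLp (average (mollKernel K) f) p := by
  obtain ⟨C, hC⟩ := exists_bound_of_continuous (continuous_mollKernel (E := E) hK)
  exact MemLp.of_bound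
    (continuous_average (continuous_mollKernel hK) hf).aestronglyMeasurable _
    (ae_of_all _ (norm_average_le hC hf))

lemma integral_norm_sq_average_le {ε A : ℝ} {K : Torus L → ℝ} (hK : IsAnnularKernel ε A K)
    (hf : MemLp f 2) :
    ∫ x, ‖average (mollKernel K) f x‖ ^ 2 ≤ (eLpNorm f 2 volume).toReal ^ 2 := by
  have hfi := hf.integrable one_le_two
  rw [integral_norm_sq_eq (memLp_average hK.smooth.continuous hfi 2).1]
  gcongr
  exacts [hf.eLpNorm_ne_top, eLpNorm_average_le hK hf.1]

variable [CompleteSpace E]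

lemma eLpNorm_average_sub_le {ε A : ℝ} {K : Torus L → ℝ} (hK : IsAnnularKernel ε A K)
    (hf : Integrable f) {D : ℝ≥0∞}
    (hD : ∀ z, K z ≠ 0 → eLpNorm (fun x => f (x + z) - f x) 2 volume ≤ D) :
    eLpNorm (fun x => average (mollKernel K) f x - f x) 2 volume ≤ D :=
  eLpNorm_two_le_of_enorm_le_lintegral hK.smooth.continuous.aestronglyMeasurable.enorm
    hK.lintegral_enorm (aestronglyMeasurable_translate_sub hf.1)
    (fun z => (aestronglyMeasurable_comp_add_right hf.1 z).sub hf.1)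
    (enorm_average_mollKernel_sub_le hK.smooth.continuous hK.integral_eq_one hf)
    fun z hz => hD z (enorm_ne_zero.1 hz)

lemma tendsto_eLpNorm_average_sub {A : ℝ} {ε : ℕ → ℝ} (hε : Tendsto ε atTop (𝓝 0))
    {K : ℕ → Torus L → ℝ} (hK : ∀ n, IsAnnularKernel (ε n) A (K n)) (hf : MemLp f 2) :
    Tendsto (fun n => eLpNorm (average (mollKernel (K n)) f - f) 2 volume) atTop (𝓝 0) := by
  have : Fact ((2 : ℝ≥0∞) ≠ ⊤) := ⟨ENNReal.ofNat_ne_top⟩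
  have htranslate := (tendsto_eLpNorm_translate_sub hf).comp
    (continuous_proj.tendsto' (0 : E3) 0 (by ext; simp [proj]))
  rw [ENNReal.tendsto_nhds_zero] at htranslate ⊢
  intro D hD
  obtain ⟨δ, hδ, hball⟩ := Metric.eventually_nhds_iff.1 (htranslate D hD)
  have h4 : Tendsto (fun n => 4 * ε n) atTop (𝓝 0) := by simpa using hε.const_mul 4
  filter_upwards [h4.eventually_lt_const hδ] with n hn
  refine eLpNorm_average_sub_le (hK n) (hf.integrable one_le_two) fun z hz => ?_
  obtain ⟨ℓ, rfl, -, hℓ⟩ := (hK n).exists_proj_eq (.inl hz)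
  exact hball (by rw [dist_zero_right]; exact hℓ.trans_lt hn)

lemma tendsto_integral_norm_sq_average {A : ℝ} {ε : ℕ → ℝ} (hε : Tendsto ε atTop (𝓝 0))
    {K : ℕ → Torus L → ℝ} (hK : ∀ n, IsAnnularKernel (ε n) A (K n)) (hf : MemLp f 2) :
    Tendsto (fun n => ∫ x, ‖average (mollKernel (K n)) f x‖ ^ 2) atTop (𝓝 (∫ x, ‖f x‖ ^ 2)) := by
  have hmem (n : ℕ) : MemLp (average (mollKernel (K n)) f) 2 :=
    memLp_average (hK n).smooth.continuous (hf.integrable one_le_two) 2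
  have hlim := ((Lp.tendsto_Lp_iff_tendsto_eLpNorm'' _ hmem f hf).2
    (tendsto_eLpNorm_average_sub hε hK hf)).norm.pow 2
  simp only [Lp.norm_toLp] at hlim
  rw [integral_norm_sq_eq hf.1]
  exact hlim.congr fun n => (integral_norm_sq_eq (hmem n).1).symm

end Convergence

section AverageInTime

variable {L : ℝ} [Fact (0 < L)] {E F : Type*} [NormedAddCommGroup E] [NormedSpace ℝ E]
  [NormedAddCommGroup F] [NormedSpace ℝ F] {τ : Measure ℝ} {M : Torus L → E →L[ℝ] F}
  {f : ℝ → Torus L → E}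

lemma integrable_prod_kernel_apply (hM : Continuous M)
    (hf : Integrable (fun p : ℝ × Torus L => f p.1 p.2) (τ.prod volume)) (x : Torus L) :
    Integrable (fun p : ℝ × Torus L => M (p.2 - x) (f p.1 p.2)) (τ.prod volume) := by
  obtain ⟨C, hC⟩ := exists_bound_of_continuous hM
  have hMx : Continuous fun p : ℝ × Torus L => M (p.2 - x) :=
    hM.comp (continuous_snd.sub continuous_const)
  exact Integrable.mono' (hf.norm.const_mul C)
    (ContinuousLinearMap.aestronglyMeasurable_comp₂ (.id ℝ _) hMx.aestronglyMeasurable hf.1)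
    (ae_of_all _ fun p => (M _).le_of_opNorm_le (hC _) _)

lemma integrable_average_apply (hM : Continuous M)
    (hf : Integrable (fun p : ℝ × Torus L => f p.1 p.2) (τ.prod volume)) (x : Torus L) :
    Integrable (fun t => average M (f t) x) τ := by
  simp only [average_eq_integral_sub]
  exact (integrable_prod_kernel_apply hM hf x).integral_prod_left

lemma integrable_prod_average [SFinite τ] (hM : Continuous M)
    (hf : Integrable (fun p : ℝ × Torus L => f p.1 p.2) (τ.prod volume)) :
    Integrable (fun p : ℝ × Torus L => average M (f p.1) p.2) (τ.prod volume) := by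
  obtain ⟨C, hC⟩ := exists_bound_of_continuous hM
  refine Integrable.mono' ((hf.norm.integral_prod_left.const_mul C).comp_fst _)
    (aestronglyMeasurable_average hM hf.1) ?_
  filter_upwards [Measure.quasiMeasurePreserving_fst.ae hf.prod_right_ae] with p hp
  exact norm_average_le hC hp _

end AverageInTime

section Evolution

variable {L : ℝ} [Fact (0 < L)]

lemma integral_prod_mul_inner_kernel {E F : Type*} [NormedAddCommGroup E] [NormedSpace ℝ E]
    [NormedAddCommGroup F] [InnerProductSpace ℝ F] [CompleteSpace F] {τ : Measure ℝ} [SFinite τ]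
    {M : Torus L → E →L[ℝ] F} (hM : Continuous M) {f : ℝ → Torus L → E}
    (hf : Integrable (fun p : ℝ × Torus L => f p.1 p.2) (τ.prod volume)) (x : Torus L) (e : F)
    {η : ℝ → ℝ} (hη : Continuous η) (hηc : HasCompactSupport η) :
    Integrable (fun p : ℝ × Torus L => inner ℝ e (M (p.2 - x) (f p.1 p.2)) * η p.1)
        (τ.prod volume) ∧
      ∫ p, inner ℝ e (M (p.2 - x) (f p.1 p.2)) * η p.1 ∂(τ.prod volume)
        = ∫ t, inner ℝ e (average M (f t) x) * η t ∂τ := by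
  obtain ⟨C, hC⟩ := hηc.exists_bound_of_continuous hη
  have hFi : Integrable (fun p : ℝ × Torus L => inner ℝ e (M (p.2 - x) (f p.1 p.2)) * η p.1)
      (τ.prod volume) :=
    ((integrable_prod_kernel_apply hM hf x).const_inner e).mul_bdd
      hη.aestronglyMeasurable.comp_fst (ae_of_all _ fun p => hC p.1)
  refine ⟨hFi, (integral_prod _ hFi).trans (integral_congr_ae ?_)⟩
  filter_upwards [hf.prod_right_ae] with t ht
  have hMx : Integrable fun y => M (y - x) (f t y) :=
    integrable_kernel_apply (hM.comp (continuous_sub_right x)) ht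
  rw [integral_mul_const, average_eq_integral_sub, integral_inner hMx]

lemma HasWeakDeriv.norm_sq {a c : ℝ} (hac : a < c) {E : Type*} [NormedAddCommGroup E]
    [InnerProductSpace ℝ E] [FiniteDimensional ℝ E] {g h : ℝ → E}
    (H : ∀ e : E, HasWeakDeriv a c (fun t => inner ℝ e (g t)) (fun t => inner ℝ e (h t)))
    (hg : IntegrableOn g (Ioo a c)) (hh : IntegrableOn h (Ioo a c)) :
    HasWeakDeriv a c (fun t => ‖g t‖ ^ 2) (fun t => 2 * inner ℝ (g t) (h t)) := by
  let e := stdOrthonormalBasis ℝ E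
  have coord (i) {k : ℝ → E} (hk : IntegrableOn k (Ioo a c) volume) :
      IntegrableOn (fun t => inner ℝ (e i) (k t)) (Ioo a c) := hk.integrable.const_inner (e i)
  have hmul (i) := (H (e i)).mul hac (coord i hg) (coord i hh) (coord i hg) (coord i hh) (H (e i))
  have hFi (i) {k : ℝ → E} (hk : IntegrableOn k (Ioo a c) volume) :
      IntegrableOn (fun t => inner ℝ (e i) (k t) * inner ℝ (e i) (g t)) (Ioo a c) :=
    (H (e i)).integrableOn_mul hac (coord i hg) (coord i hh) (coord i hk)
  have hsum := HasWeakDeriv.sum (s := Finset.univ) (fun i _ => hmul i) (fun i _ => hFi i hg)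
    (fun i _ => (hFi i hh).add (by simpa only [mul_comm] using hFi i hh))
  refine hsum.congr (ae_of_all _ fun t => ?_) (ae_of_all _ fun t => ?_)
  · beta_reduce
    rw [← real_inner_self_eq_norm_sq, ← e.sum_inner_mul_inner]
    exact Finset.sum_congr rfl fun i _ => by rw [real_inner_comm (e i)]
  · beta_reduce
    rw [← e.sum_inner_mul_inner, Finset.mul_sum]
    exact Finset.sum_congr rfl fun i _ => by rw [real_inner_comm (e i)]; ring

variable {T : ℝ} {b j : ℝ → Torus L → E3}

namespace IsWeakSolution

lemma exists_integral_norm_le (hb : IsWeakSolution T b j) :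
    ∃ M : ℝ, ∀ᵐ t ∂(volume.restrict (Ioo 0 T)), Integrable (b t) ∧ ∫ x, ‖b t x‖ ≤ M := by
  obtain ⟨M, hM⟩ := hb.finite_energy
  let V : ℝ≥0∞ :=
    volume (univ : Set (Torus L)) ^ (1 / (1 : ℝ≥0∞).toReal - 1 / (2 : ℝ≥0∞).toReal)
  have hV : V ≠ ⊤ := ENNReal.rpow_ne_top_of_nonneg (by norm_num) (measure_ne_top _ _)
  refine ⟨(ENNReal.ofReal M * V).toReal, hM.mono fun t ht => ?_⟩
  refine ⟨ht.1.integrable (by norm_num), ?_⟩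
  rw [integral_norm_eq_lintegral_enorm ht.1.1, ← eLpNorm_one_eq_lintegral_enorm]
  exact ENNReal.toReal_mono (ENNReal.mul_ne_top ENNReal.ofReal_ne_top hV)
    ((eLpNorm_le_eLpNorm_mul_rpow_measure_univ (by norm_num) ht.1.1).trans
      (mul_le_mul_left ht.2 _))

lemma integrable_magneticField (hb : IsWeakSolution T b j) :
    Integrable (fun p : ℝ × Torus L => b p.1 p.2) (spaceTime L T) := by
  obtain ⟨M, hM⟩ := hb.exists_integral_norm_le
  refine (integrable_prod_iff hb.measurable_b).2 ⟨hM.mono fun t ht => ht.1, ?_⟩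
  refine Integrable.mono' (integrable_const M) hb.measurable_b.norm.integral_prod_right' ?_
  filter_upwards [hM] with t ht
  rw [Real.norm_of_nonneg (integral_nonneg fun _ => norm_nonneg _)]
  exact ht.2

end IsWeakSolution

lemma restrict_Ioo_prod (a c : ℝ) :
    (volume.restrict (Ioo a c)).prod (volume : Measure (Torus L))
      = (volume.prod volume).restrict (Ioo a c ×ˢ univ) := by
  rw [← Measure.prod_restrict, Measure.restrict_univ]

namespace IsWeakSolution

variable {a c : ℝ}

lemma integrable_magneticField_Ioo (hb : IsWeakSolution T b j) (ha : 0 ≤ a) (hc : c ≤ T) :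
    Integrable (fun p : ℝ × Torus L => b p.1 p.2) ((volume.restrict (Ioo a c)).prod volume) := by
  refine hb.integrable_magneticField.mono_measure ?_
  rw [spaceTime, restrict_Ioo_prod, restrict_Ioo_prod]
  exact Measure.restrict_mono (prod_mono (Ioo_subset_Ioo ha hc) le_rfl) le_rfl

lemma integrable_nonlinearity_Ioo (hb : IsWeakSolution T b j) (ha : 0 < a) (hc : c < T) :
    Integrable (fun p : ℝ × Torus L => cross (j p.1 p.2) (b p.1 p.2))
      ((volume.restrict (Ioo a c)).prod volume) := by
  rw [restrict_Ioo_prod]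
  exact (hb.integrable_nonlinearity.integrableOn_compact_subset (t := Icc a c ×ˢ univ)
    (prod_mono (Icc_subset_Ioo ha hc) le_rfl) (isCompact_Icc.prod isCompact_univ)).mono_set
      (prod_mono Ioo_subset_Icc_self le_rfl)

/- The equation is tested against the separated field `θ(t) K(y - x) e`. -/
lemma integral_separated_eq_zero (hb : IsWeakSolution T b j) {θ : ℝ → ℝ}
    (hθ : IsTimeTest 0 T θ) {K : Torus L → ℝ} (hK : IsSmooth K) (x : Torus L) (e : E3) :
    ∫ p, (inner ℝ e (mollKernel K (p.2 - x) (b p.1 p.2)) * deriv θ p.1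
      - inner ℝ e (curlKernel K (p.2 - x) (cross (j p.1 p.2) (b p.1 p.2))) * θ p.1)
        ∂(spaceTime L T) = 0 := by
  let Φ : ℝ → Torus L → E3 := fun t y => (θ t * K (y - x)) • e
  have hΦ : IsTestField T Φ := by
    obtain ⟨a', c', ha, hc, hθ0⟩ := hθ.exists_Icc
    refine ⟨?_, a', c', ha, hc, fun t ht y => by simp [Φ, hθ0 t ht]⟩
    have hKx : ContDiff ℝ ∞ fun p : ℝ × E3 => K (proj L p.2 - x) :=
      ContDiff.comp (g := fun y => K (proj L y - x)) (hK.comp_sub_right x) contDiff_snd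
    exact ((hθ.contDiff.comp contDiff_fst).mul hKx).smul contDiff_const
  have hderiv (t : ℝ) (y : Torus L) :
      deriv (fun s => Φ s y) t = (deriv θ t * K (y - x)) • e :=
    (((hθ.hasDerivAt t).mul_const (K (y - x))).smul_const e).deriv
  have hcurl (t : ℝ) (y : Torus L) : curl (Φ t) y = cross (θ t • torusGrad K (y - x)) e := by
    rw [curl_smul_const, torusGrad_const_mul (fun y => K (y - x)), torusGrad_comp_sub_right]
  rw [← hb.equation Φ hΦ]
  refine integral_congr_ae (ae_of_all _ fun p => ?_)
  simp only [hderiv, hcurl, inner_cross_cyclic, mollKernel_apply, curlKernel_apply,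
    inner_smul_right, real_inner_comm e]
  ring

lemma hasWeakDeriv_inner_average (hb : IsWeakSolution T b j) (ha : 0 < a) (hc : c < T)
    {K : Torus L → ℝ} (hK : IsSmooth K) (x : Torus L) (e : E3) :
    HasWeakDeriv a c (fun t => inner ℝ e (average (mollKernel K) (b t) x))
      (fun t => inner ℝ e (-average (curlKernel K) (fun y => cross (j t y) (b t y)) x)) := by
  intro θ hθ
  obtain ⟨hb_int, hb_eq⟩ := integral_prod_mul_inner_kernel (continuous_mollKernel hK.continuous)
    (hb.integrable_magneticField_Ioo ha.le hc.le) x e hθ.continuous_deriv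
    hθ.hasCompactSupport.deriv
  obtain ⟨hF_int, hF_eq⟩ := integral_prod_mul_inner_kernel (continuous_curlKernel hK)
    (f := fun t y => cross (j t y) (b t y)) (hb.integrable_nonlinearity_Ioo ha hc) x e
    hθ.contDiff.continuous hθ.hasCompactSupport
  have hθT : IsTimeTest 0 T θ :=
    ⟨hθ.contDiff, hθ.hasCompactSupport, hθ.tsupport_subset.trans (Ioo_subset_Ioo ha.le hc.le)⟩
  simp only [inner_neg_right, neg_mul, integral_neg, neg_neg]
  rw [← hb_eq, ← hF_eq, ← sub_eq_zero, ← integral_sub hb_int hF_int,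
    ← hb.integral_separated_eq_zero hθT hK x e, spaceTime, restrict_Ioo_prod, restrict_Ioo_prod]
  refine (setIntegral_eq_of_subset_of_forall_sdiff_eq_zero
    (measurableSet_Ioo.prod MeasurableSet.univ)
    (prod_mono (Ioo_subset_Ioo ha.le hc.le) le_rfl) fun p hp => ?_).symm
  have hpt : p.1 ∉ Ioo a c := fun h => hp.2 ⟨h, mem_univ _⟩
  rw [hθ.eq_zero_of_notMem hpt, hθ.deriv_eq_zero_of_notMem hpt, mul_zero, mul_zero, sub_zero]

lemma hasWeakDeriv_norm_sq_average (hb : IsWeakSolution T b j) (ha : 0 < a) (hac : a < c)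
    (hc : c < T) {K : Torus L → ℝ} (hK : IsSmooth K) (x : Torus L) :
    HasWeakDeriv a c (fun t => ‖average (mollKernel K) (b t) x‖ ^ 2)
      (fun t => 2 * inner ℝ (average (mollKernel K) (b t) x)
        (-average (curlKernel K) (fun y => cross (j t y) (b t y)) x)) :=
  HasWeakDeriv.norm_sq hac (hb.hasWeakDeriv_inner_average ha hc hK x)
    (integrable_average_apply (continuous_mollKernel hK.continuous)
      (hb.integrable_magneticField_Ioo ha.le hc.le) x)
    (integrable_average_apply (f := fun t y => cross (j t y) (b t y)) (continuous_curlKernel hK)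
      (hb.integrable_nonlinearity_Ioo ha hc) x).neg

lemma exists_norm_average_le (hb : IsWeakSolution T b j) {K : Torus L → ℝ} (hK : Continuous K) :
    ∃ C, ∀ᵐ t ∂(volume.restrict (Ioo 0 T)), ∀ x, ‖average (mollKernel K) (b t) x‖ ≤ C := by
  obtain ⟨M, hM⟩ := hb.exists_integral_norm_le
  obtain ⟨D, hD⟩ := exists_bound_of_continuous (continuous_mollKernel (E := E3) hK)
  refine ⟨D * M, hM.mono fun t ht x => (norm_average_le hD ht.1 x).trans ?_⟩
  exact mul_le_mul_of_nonneg_left ht.2 ((norm_nonneg _).trans (hD 0))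

lemma hasWeakDeriv_integral_norm_sq_average (hb : IsWeakSolution T b j) (ha : 0 < a)
    (hac : a < c) (hc : c < T) {K : Torus L → ℝ} (hK : IsSmooth K) :
    HasWeakDeriv a c (fun t => ∫ x, ‖average (mollKernel K) (b t) x‖ ^ 2)
      (fun t => -2 * energyFlux K (b t) (j t)) := by
  have hle : volume.restrict (Ioo a c) ≤ volume.restrict (Ioo 0 T) :=
    Measure.restrict_mono (Ioo_subset_Ioo ha.le hc.le) le_rfl
  have hb_int := hb.integrable_magneticField_Ioo ha.le hc.le
  have hF_int := hb.integrable_nonlinearity_Ioo ha hc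
  have hKc := continuous_mollKernel (E := E3) hK.continuous
  obtain ⟨C, hC⟩ := hb.exists_norm_average_le hK.continuous
  have hC' : ∀ᵐ p ∂((volume.restrict (Ioo a c)).prod (volume : Measure (Torus L))),
      ‖average (mollKernel K) (b p.1) p.2‖ ≤ C := by
    filter_upwards [Measure.quasiMeasurePreserving_fst.ae (ae_mono hle hC)] with p hp using hp _
  have hg := integrable_prod_average hKc hb_int
  have hh := (integrable_prod_average (f := fun t y => cross (j t y) (b t y))
    (continuous_curlKernel hK) hF_int).neg
  refine (HasWeakDeriv.integral (ae_of_all _ (hb.hasWeakDeriv_norm_sq_average ha hac hc hK))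
    ?_ ?_).congr (.refl _ _) ?_
  · simpa only [sq] using hg.norm.mul_bdd hg.1.norm (by simpa only [norm_norm] using hC')
  · refine (Integrable.mono' (hh.norm.const_mul C) (hg.1.inner hh.1) ?_).const_mul 2
    filter_upwards [hC'] with p hp
    exact (norm_inner_le_norm _ _).trans (mul_le_mul_of_nonneg_right hp (norm_nonneg _))
  filter_upwards [hb_int.prod_right_ae, hF_int.prod_right_ae, ae_mono hle hb.current]
    with t hbt hFt hjt
  simp only [energyFlux, inner_neg_right, mul_neg, neg_mul, integral_neg, integral_const_mul]
  rw [(hjt.2.average hbt hjt.1 hK.continuous).integral_inner_average_curlKernel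
    (continuous_average hKc hbt) (continuous_average hKc hjt.1) hFt hK]

end IsWeakSolution

end Evolution

/-- The products of increments in `IncrementBound` are `o(ε) Q(t)` as `ε → 0⁺`, with the `o(ε)`
uniform in `t ∈ (0,T)`. -/
def IncrementLittleO {L : ℝ} [Fact (0 < L)] (p q : ℝ≥0∞) (T : ℝ) (b j : ℝ → Torus L → E3)
    (Q : ℝ → ℝ) : Prop :=
  ∀ η > 0, ∀ᶠ ε in 𝓝[>] (0 : ℝ), ∀ᵐ t ∂(volume.restrict (Ioo 0 T)),
    IncrementBound p q (j t) (b t) ε (ENNReal.ofReal (ε * η * Q t))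

section Modulus

lemma tendsto_mul_mul_prod_zero {X : Type*} {l : Filter X} {f g : X → ℝ}
    (hf : f =O[l] fun _ => (1 : ℝ)) (hg : g =O[l] fun _ => (1 : ℝ))
    (hfg : Tendsto f l (𝓝 0) ∨ Tendsto g l (𝓝 0)) :
    Tendsto (fun x : X × X × X => g x.1 * (f x.2.1 * f x.2.2)) (l ×ˢ l ×ˢ l) (𝓝 0) := by
  have hl₀ : Tendsto (fun x : X × X × X => x.1) (l ×ˢ l ×ˢ l) l := tendsto_fst
  have hl₁ : Tendsto (fun x : X × X × X => x.2.1) (l ×ˢ l ×ˢ l) l := tendsto_fst.comp tendsto_snd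
  have hl₂ : Tendsto (fun x : X × X × X => x.2.2) (l ×ˢ l ×ˢ l) l := tendsto_snd.comp tendsto_snd
  simp only [← Asymptotics.isLittleO_one_iff ℝ] at hfg ⊢
  rcases hfg with h | h
  · simpa using (hg.comp_tendsto hl₀).mul_isLittleO
      ((h.comp_tendsto hl₁).mul_isBigO (hf.comp_tendsto hl₂))
  · simpa using (h.comp_tendsto hl₀).mul_isBigO
      ((hf.comp_tendsto hl₁).mul (hf.comp_tendsto hl₂))

lemma eventually_forall_norm_le_of_eventually_prod {X : Type*} [NormedAddCommGroup X]
    {P : X × X × X → Prop} (h : ∀ᶠ x in 𝓝[≠] (0 : X) ×ˢ 𝓝[≠] (0 : X) ×ˢ 𝓝[≠] (0 : X), P x)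
    (k : ℝ) :
    ∀ᶠ ε in 𝓝[>] (0 : ℝ), ∀ x₀ x₁ x₂ : X,
      ‖x₀‖ ∈ Ioc 0 (k * ε) → ‖x₁‖ ∈ Ioc 0 (k * ε) → ‖x₂‖ ∈ Ioc 0 (k * ε) → P (x₀, x₁, x₂) := by
  have hl := nhdsWithin_hasBasis (Metric.nhds_basis_ball (x := (0 : X))) {0}ᶜ
  obtain ⟨⟨δ₀, δ₁, δ₂⟩, ⟨hδ₀, hδ₁, hδ₂⟩, hP⟩ := (hl.prod (hl.prod hl)).eventually_iff.1 h
  have hk : Tendsto (fun ε : ℝ => k * ε) (𝓝[>] 0) (𝓝 0) := by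
    simpa using (tendsto_id.const_mul k).mono_left (nhdsWithin_le_nhds (a := (0 : ℝ)) (s := Ioi 0))
  filter_upwards [hk.eventually_lt_const hδ₀, hk.eventually_lt_const hδ₁,
    hk.eventually_lt_const hδ₂] with ε h₀ h₁ h₂ x₀ x₁ x₂ hx₀ hx₁ hx₂
  have mem {δ : ℝ} (hδ : k * ε < δ) {x : X} (hx : ‖x‖ ∈ Ioc 0 (k * ε)) :
      x ∈ Metric.ball 0 δ ∩ {0}ᶜ :=
    ⟨mem_ball_zero_iff.2 (hx.2.trans_lt hδ), norm_pos_iff.1 hx.1⟩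
  exact hP ⟨mem h₀ hx₀, mem h₁ hx₁, mem h₂ hx₂⟩

lemma rpow_le_of_mem_Icc {ε x α k : ℝ} (hε : 0 < ε) (hx : x ∈ Icc ε (k * ε)) :
    x ^ α ≤ k ^ |α| * ε ^ α := by
  have hratio : 1 ≤ x / ε := (one_le_div hε).2 hx.1
  calc x ^ α = (x / ε) ^ α * ε ^ α := by
        rw [← Real.mul_rpow (zero_le_one.trans hratio) hε.le, div_mul_cancel₀ _ hε.ne']
    _ ≤ k ^ |α| * ε ^ α := by
        gcongr
        exact (Real.rpow_le_rpow_of_exponent_le hratio (le_abs_self α)).trans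
          (Real.rpow_le_rpow (zero_le_one.trans hratio) ((div_le_iff₀ hε).2 hx.2) (abs_nonneg _))

lemma rpow_mul_rpow_mul_rpow_le {ε x₀ x₁ x₂ α β k : ℝ} (hε : 0 < ε) (hε1 : ε ≤ 1)
    (hαβ : 1 ≤ 2 * α + β) (h₀ : x₀ ∈ Icc ε (k * ε)) (h₁ : x₁ ∈ Icc ε (k * ε))
    (h₂ : x₂ ∈ Icc ε (k * ε)) :
    x₀ ^ β * (x₁ ^ α * x₂ ^ α) ≤ k ^ |β| * (k ^ |α|) ^ 2 * ε := by
  have hx₁ : 0 < x₁ := hε.trans_le h₁.1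
  have hx₂ : 0 < x₂ := hε.trans_le h₂.1
  have hk : 0 < k := pos_of_mul_pos_left (hx₁.trans_le h₁.2) hε.le
  calc x₀ ^ β * (x₁ ^ α * x₂ ^ α)
      ≤ (k ^ |β| * ε ^ β) * ((k ^ |α| * ε ^ α) * (k ^ |α| * ε ^ α)) := by
        gcongr <;> apply rpow_le_of_mem_Icc <;> assumption
    _ = k ^ |β| * (k ^ |α|) ^ 2 * ε ^ (2 * α + β) := by
        rw [two_mul, Real.rpow_add hε, Real.rpow_add hε]; ring
    _ ≤ k ^ |β| * (k ^ |α|) ^ 2 * ε := by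
        gcongr
        simpa using Real.rpow_le_rpow_of_exponent_ge hε hε1 hαβ

lemma sq_rpow_mul_rpow_le {r₁ r₂ x y : ℝ} (hr₁ : 0 < r₁) (hr₂ : 0 < r₂)
    (hr : 2 / r₁ + 1 / r₂ = 1) (hx : 0 ≤ x) (hy : 0 ≤ y) :
    (x ^ (1 / r₁)) ^ 2 * y ^ (1 / r₂) ≤ 2 / r₁ * x + 1 / r₂ * y := by
  rw [← Real.rpow_mul_natCast hx, show 1 / r₁ * ((2 : ℕ) : ℝ) = 2 / r₁ by push_cast; ring]
  exact Real.geom_mean_le_arith_mean2_weighted (by positivity) (by positivity) hx hy hr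

lemma isBigO_one_rpow_of_forall_le {X : Type*} [NormedAddCommGroup X] {σ : X → ℝ} {ρ K s : ℝ}
    (hρ : 0 < ρ) (hs : 0 ≤ s) (hσ : ∀ x, ‖x‖ < ρ → 0 ≤ σ x ∧ σ x ≤ K) :
    (fun x => σ x ^ s) =O[𝓝[≠] 0] fun _ => (1 : ℝ) := by
  have hball : ∀ᶠ x in 𝓝 (0 : X), ‖x‖ < ρ :=
    (continuous_norm.tendsto' 0 0 norm_zero).eventually_lt_const hρ
  refine .of_bound (K ^ s) ((hball.filter_mono nhdsWithin_le_nhds).mono fun x hx => ?_)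
  rw [norm_one, mul_one, Real.norm_of_nonneg (Real.rpow_nonneg (hσ x hx).1 s)]
  exact Real.rpow_le_rpow (hσ x hx).1 (hσ x hx).2 hs

variable {L : ℝ} [Fact (0 < L)] {p q : ℝ≥0∞} {α β r₁ r₂ ρ s : ℝ} {σ₁ σ₂ : E3 → ℝ}

lemma incrementBound_of_modulus {ε η c₁ c₂ : ℝ} (hε : 0 < ε) (hε1 : ε ≤ 1) (hερ : 4 * ε < ρ)
    (hαβ : 1 ≤ 2 * α + β) (hr₁ : 0 < r₁) (hr₂ : 0 < r₂) (hr : 2 / r₁ + 1 / r₂ = 1)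
    (hc₁ : 0 ≤ c₁) (hc₂ : 0 ≤ c₂)
    (hσ₁ : ∀ ℓ, ‖ℓ‖ < ρ → 0 ≤ σ₁ ℓ) (hσ₂ : ∀ ℓ, ‖ℓ‖ < ρ → 0 ≤ σ₂ ℓ)
    (hσ : ∀ ℓ₀ ℓ₁ ℓ₂ : E3, ‖ℓ₀‖ ∈ Ioc 0 (4 * ε) → ‖ℓ₁‖ ∈ Ioc 0 (4 * ε) →
      ‖ℓ₂‖ ∈ Ioc 0 (4 * ε) → σ₂ ℓ₀ ^ s * (σ₁ ℓ₁ ^ s * σ₁ ℓ₂ ^ s) ≤ η)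
    {U J : Torus L → E3}
    (hU : ∀ ℓ : E3, ‖ℓ‖ < ρ →
      eLpNorm (incr U ℓ) q volume ≤ ENNReal.ofReal (c₁ ^ (1 / r₁) * ‖ℓ‖ ^ α * σ₁ ℓ ^ s))
    (hJ : ∀ ℓ : E3, ‖ℓ‖ < ρ →
      eLpNorm (incr J ℓ) p volume ≤ ENNReal.ofReal (c₂ ^ (1 / r₂) * ‖ℓ‖ ^ β * σ₂ ℓ ^ s)) :
    IncrementBound p q J U ε (ENNReal.ofReal
      (ε * (4 ^ |β| * (4 ^ |α|) ^ 2 * η) * (2 / r₁ * c₁ + 1 / r₂ * c₂))) := by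
  intro ℓ₀ ℓ₁ ℓ₂ h₀ h₁ h₂
  have hsmall {ℓ : E3} (h : ‖ℓ‖ ∈ Icc ε (4 * ε)) : ‖ℓ‖ < ρ := h.2.trans_lt hερ
  have hpos {ℓ : E3} (h : ‖ℓ‖ ∈ Icc ε (4 * ε)) : ‖ℓ‖ ∈ Ioc 0 (4 * ε) := ⟨hε.trans_le h.1, h.2⟩
  have hs₀ := Real.rpow_nonneg (hσ₂ _ (hsmall h₀)) s
  have hs₁ := Real.rpow_nonneg (hσ₁ _ (hsmall h₁)) s
  have hs₂ := Real.rpow_nonneg (hσ₁ _ (hsmall h₂)) s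
  have hη : 0 ≤ η := le_trans (by positivity) (hσ _ _ _ (hpos h₀) (hpos h₁) (hpos h₂))
  refine (mul_le_mul' (hJ _ (hsmall h₀))
    (mul_le_mul' (hU _ (hsmall h₁)) (hU _ (hsmall h₂)))).trans ?_
  rw [← ENNReal.ofReal_mul (by positivity), ← ENNReal.ofReal_mul (by positivity)]
  refine ENNReal.ofReal_le_ofReal ?_
  calc _ = ‖ℓ₀‖ ^ β * (‖ℓ₁‖ ^ α * ‖ℓ₂‖ ^ α) * (σ₂ ℓ₀ ^ s * (σ₁ ℓ₁ ^ s * σ₁ ℓ₂ ^ s))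
        * ((c₁ ^ (1 / r₁)) ^ 2 * c₂ ^ (1 / r₂)) := by ring
    _ ≤ (4 ^ |β| * (4 ^ |α|) ^ 2 * ε) * η * (2 / r₁ * c₁ + 1 / r₂ * c₂) := by
        gcongr ?_ * ?_ * ?_
        · exact rpow_mul_rpow_mul_rpow_le hε hε1 hαβ h₀ h₁ h₂
        · exact hσ _ _ _ (hpos h₀) (hpos h₁) (hpos h₂)
        · exact sq_rpow_mul_rpow_le hr₁ hr₂ hr hc₁ hc₂
    _ = _ := by ring

lemma incrementLittleO_of_modulus {T K : ℝ} {b j : ℝ → Torus L → E3} {C₁ C₂ : ℝ → ℝ}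
    (hr₁ : 0 < r₁) (hr₂ : 0 < r₂) (hr : 2 / r₁ + 1 / r₂ = 1) (hαβ : 1 ≤ 2 * α + β)
    (hC₁ : ∀ t ∈ Ioo 0 T, 0 ≤ C₁ t) (hC₂ : ∀ t ∈ Ioo 0 T, 0 ≤ C₂ t) (hρ : 0 < ρ) (hs : 0 < s)
    (hσ₁ : ∀ ℓ, ‖ℓ‖ < ρ → 0 ≤ σ₁ ℓ ∧ σ₁ ℓ ≤ K) (hσ₂ : ∀ ℓ, ‖ℓ‖ < ρ → 0 ≤ σ₂ ℓ ∧ σ₂ ℓ ≤ K)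
    (hσ : Tendsto σ₁ (𝓝[≠] 0) (𝓝 0) ∨ Tendsto σ₂ (𝓝[≠] 0) (𝓝 0))
    (hb : ∀ᵐ t ∂(volume.restrict (Ioo 0 T)), ∀ ℓ : E3, ‖ℓ‖ < ρ →
      eLpNorm (incr (b t) ℓ) q volume
        ≤ ENNReal.ofReal (C₁ t ^ (1 / r₁) * ‖ℓ‖ ^ α * σ₁ ℓ ^ s))
    (hj : ∀ᵐ t ∂(volume.restrict (Ioo 0 T)), ∀ ℓ : E3, ‖ℓ‖ < ρ →
      eLpNorm (incr (j t) ℓ) p volume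
        ≤ ENNReal.ofReal (C₂ t ^ (1 / r₂) * ‖ℓ‖ ^ β * σ₂ ℓ ^ s)) :
    IncrementLittleO p q T b j fun t => 2 / r₁ * C₁ t + 1 / r₂ * C₂ t := by
  intro η hη
  let B : ℝ := 4 ^ |β| * (4 ^ |α|) ^ 2
  have hB : 0 < B := by positivity
  have hlim {σ : E3 → ℝ} (h : Tendsto σ (𝓝[≠] 0) (𝓝 0)) :
      Tendsto (fun ℓ => σ ℓ ^ s) (𝓝[≠] 0) (𝓝 0) := by
    simpa [Real.zero_rpow hs.ne'] using h.rpow_const (.inr hs.le)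
  have hprod := tendsto_mul_mul_prod_zero (isBigO_one_rpow_of_forall_le hρ hs.le hσ₁)
    (isBigO_one_rpow_of_forall_le hρ hs.le hσ₂) (hσ.imp hlim hlim)
  have hsmall := eventually_forall_norm_le_of_eventually_prod
    (hprod.eventually_le_const (div_pos hη hB)) 4
  filter_upwards [hsmall, Ioo_mem_nhdsGT (show 0 < min 1 (ρ / 4) by positivity)] with ε hε hεmem
  filter_upwards [hb, hj, ae_restrict_mem measurableSet_Ioo] with t hbt hjt ht
  obtain ⟨hε1, hερ⟩ := lt_min_iff.1 hεmem.2
  have hbound := incrementBound_of_modulus hεmem.1 hε1.le (by linarith) hαβ hr₁ hr₂ hr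
    (hC₁ t ht) (hC₂ t ht) (fun ℓ hℓ => (hσ₁ ℓ hℓ).1) (fun ℓ hℓ => (hσ₂ ℓ hℓ).1) hε hbt hjt
  rwa [mul_div_cancel₀ η hB.ne'] at hbound

end Modulus

section Conservation

variable {L : ℝ} [Fact (0 < L)] {T : ℝ} {b j : ℝ → Torus L → E3} {p q : ℝ≥0∞} {Q : ℝ → ℝ}

lemma exists_sequence_isAnnularKernel (L : ℝ) [Fact (0 < L)] :
    ∃ (A : ℝ) (ε : ℕ → ℝ) (K : ℕ → Torus L → ℝ), 0 ≤ A ∧ Tendsto ε atTop (𝓝[>] 0) ∧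
      ∀ n, IsAnnularKernel (ε n) A (K n) := by
  obtain ⟨A, hA, hker⟩ := exists_isAnnularKernel
  have hL : 0 < L := Fact.out
  obtain ⟨ε, -, hε, hlim⟩ := exists_seq_strictAnti_tendsto' (half_pos hL)
  choose K hK using fun n => hker L (ε n) (hε n).1 (by linarith [(hε n).2])
  exact ⟨A, ε, K, hA,
    tendsto_nhdsWithin_iff.2 ⟨hlim, Eventually.of_forall fun n => (hε n).1⟩, hK⟩

namespace IsWeakSolution

lemma exists_integral_norm_sq_le (hb : IsWeakSolution T b j) :
    ∃ C, ∀ᵐ t ∂(volume.restrict (Ioo 0 T)), MemLp (b t) 2 ∧ (eLpNorm (b t) 2).toReal ^ 2 ≤ C := by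
  obtain ⟨M, hM⟩ := hb.finite_energy
  refine ⟨(ENNReal.ofReal M).toReal ^ 2, hM.mono fun t ht => ⟨ht.1, ?_⟩⟩
  gcongr
  exacts [ENNReal.ofReal_ne_top, ht.2]

lemma integrableOn_integral_norm_sq (hb : IsWeakSolution T b j) :
    IntegrableOn (fun t => ∫ x, ‖b t x‖ ^ 2) (Ioo 0 T) := by
  obtain ⟨C, hC⟩ := hb.exists_integral_norm_sq_le
  refine Integrable.mono' (integrable_const C) (hb.measurable_b.norm.pow 2).integral_prod_right' ?_
  filter_upwards [hC] with t ht
  rw [Real.norm_of_nonneg (by positivity), integral_norm_sq_eq ht.1.1]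
  exact ht.2

lemma aestronglyMeasurable_integral_norm_sq_average (hb : IsWeakSolution T b j)
    {K : Torus L → ℝ} (hK : Continuous K) :
    AEStronglyMeasurable (fun t => ∫ x, ‖average (mollKernel K) (b t) x‖ ^ 2)
      (volume.restrict (Ioo 0 T)) := by
  have hKc := continuous_mollKernel (E := E3) hK
  exact ((aestronglyMeasurable_average hKc hb.measurable_b).norm.pow 2).integral_prod_right'

lemma integrableOn_integral_norm_sq_average (hb : IsWeakSolution T b j) {ε A : ℝ}
    {K : Torus L → ℝ} (hK : IsAnnularKernel ε A K) :
    IntegrableOn (fun t => ∫ x, ‖average (mollKernel K) (b t) x‖ ^ 2) (Ioo 0 T) := by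
  obtain ⟨C, hC⟩ := hb.exists_integral_norm_sq_le
  refine Integrable.mono' (integrable_const C)
    (hb.aestronglyMeasurable_integral_norm_sq_average hK.smooth.continuous) ?_
  filter_upwards [hC] with t ht
  rw [Real.norm_of_nonneg (by positivity)]
  exact (integral_norm_sq_average_le hK ht.1).trans ht.2

lemma tendsto_integral_norm_sq_average_sub (hb : IsWeakSolution T b j) {A : ℝ} {ε : ℕ → ℝ}
    (hε : Tendsto ε atTop (𝓝 0)) {K : ℕ → Torus L → ℝ}
    (hK : ∀ n, IsAnnularKernel (ε n) A (K n)) :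
    Tendsto (fun n => ∫ t in Ioo 0 T,
      ‖(∫ x, ‖average (mollKernel (K n)) (b t) x‖ ^ 2) - ∫ x, ‖b t x‖ ^ 2‖) atTop (𝓝 0) := by
  obtain ⟨C, hC⟩ := hb.exists_integral_norm_sq_le
  refine (tendsto_integral_of_dominated_convergence (μ := volume.restrict (Ioo 0 T))
    (f := fun _ => (0 : ℝ)) (fun _ => C) (fun n => ?_) (integrable_const C) (fun n => ?_)
    ?_).mono_right (by rw [integral_zero])
  · exact ((hb.integrableOn_integral_norm_sq_average (hK n)).sub
      hb.integrableOn_integral_norm_sq).norm.1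
  · filter_upwards [hC] with t ht
    rw [norm_norm]
    refine abs_sub_le_of_nonneg_of_le (by positivity)
      ((integral_norm_sq_average_le (hK n) ht.1).trans ht.2) (by positivity) ?_
    rw [integral_norm_sq_eq ht.1.1]
    exact ht.2
  · filter_upwards [hC] with t ht
    exact tendsto_iff_norm_sub_tendsto_zero.1 (tendsto_integral_norm_sq_average hε hK ht.1)

lemma aestronglyMeasurable_energyFlux (hb : IsWeakSolution T b j) {K : Torus L → ℝ}
    (hK : Continuous K) :
    AEStronglyMeasurable (fun t => energyFlux K (b t) (j t)) (volume.restrict (Ioo 0 T)) := by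
  have hF : AEStronglyMeasurable (fun p : ℝ × Torus L => cross (j p.1 p.2) (b p.1 p.2))
      (spaceTime L T) := continuous_cross.comp_aestronglyMeasurable₂ hb.measurable_j hb.measurable_b
  have hKc := continuous_mollKernel (E := E3) hK
  exact ((aestronglyMeasurable_average hKc hb.measurable_j).inner (𝕜 := ℝ)
    (aestronglyMeasurable_average (f := fun t y => cross (j t y) (b t y)) hKc
      hF)).integral_prod_right'

lemma norm_energyFlux_le_of_incrementBound {a c : ℝ} (hb : IsWeakSolution T b j) (ha : 0 < a)
    (hc : c < T) (hpq : p⁻¹ + 2 * q⁻¹ = 1) {ε A η : ℝ} (hA : 0 ≤ A) (hε : 0 < ε) (hη : 0 ≤ η)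
    {K : Torus L → ℝ} (hK : IsAnnularKernel ε A K)
    (h : ∀ᵐ t ∂(volume.restrict (Ioo 0 T)),
      IncrementBound p q (j t) (b t) ε (ENNReal.ofReal (ε * η * Q t))) :
    ∀ᵐ t ∂(volume.restrict (Ioo a c)), ‖energyFlux K (b t) (j t)‖ ≤ 2 * A * η * ‖Q t‖ := by
  have hle : volume.restrict (Ioo a c) ≤ volume.restrict (Ioo 0 T) :=
    Measure.restrict_mono (Ioo_subset_Ioo ha.le hc.le) le_rfl
  filter_upwards [(hb.integrable_magneticField_Ioo ha.le hc.le).prod_right_ae,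
    (hb.integrable_nonlinearity_Ioo ha hc).prod_right_ae, ae_mono hle hb.current, ae_mono hle h]
    with t hbt hFt hjt ht
  rw [← ENNReal.ofReal_le_ofReal_iff (by positivity), ofReal_norm]
  calc ‖energyFlux K (b t) (j t)‖ₑ
      ≤ 2 * (ENNReal.ofReal (A / ε) * ENNReal.ofReal (ε * η * Q t)) :=
        enorm_energyFlux_le hpq hK hjt.2 hbt hjt.1 hFt ht
    _ = ENNReal.ofReal (2 * A * η * Q t) := by
        rw [← ENNReal.ofReal_mul (by positivity), ← ENNReal.ofReal_ofNat 2,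
          ← ENNReal.ofReal_mul zero_le_two]
        congr 1
        field_simp
    _ ≤ ENNReal.ofReal (2 * A * η * ‖Q t‖) := by
        gcongr
        exact le_abs_self _

lemma eventually_norm_energyFlux_le {a c A : ℝ} {ε : ℕ → ℝ} {K : ℕ → Torus L → ℝ}
    (hb : IsWeakSolution T b j) (ha : 0 < a) (hc : c < T) (hpq : p⁻¹ + 2 * q⁻¹ = 1)
    (h : IncrementLittleO p q T b j Q) (hA : 0 ≤ A) (hε : Tendsto ε atTop (𝓝[>] 0))
    (hK : ∀ n, IsAnnularKernel (ε n) A (K n)) {η : ℝ} (hη : 0 < η) :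
    ∀ᶠ n in atTop, ∀ᵐ t ∂(volume.restrict (Ioo a c)),
      ‖-2 * energyFlux (K n) (b t) (j t)‖ ≤ η * ‖Q t‖ := by
  have hη' : 0 < η / (4 * A + 1) := by positivity
  filter_upwards [hε.eventually (h _ hη'), hε.eventually self_mem_nhdsWithin] with n hn hεn
  filter_upwards [hb.norm_energyFlux_le_of_incrementBound ha hc hpq hA hεn hη'.le (hK n) hn]
    with t ht
  calc ‖-2 * energyFlux (K n) (b t) (j t)‖
      ≤ 2 * (2 * A * (η / (4 * A + 1)) * ‖Q t‖) := by simpa [norm_mul] using ht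
    _ = 4 * A / (4 * A + 1) * (η * ‖Q t‖) := by ring
    _ ≤ η * ‖Q t‖ :=
      mul_le_of_le_one_left (by positivity) ((div_le_one (by positivity)).2 (by linarith))

end IsWeakSolution

lemma tendsto_integral_norm_of_forall_ae_le {X ι E : Type*} [MeasurableSpace X] {μ : Measure X}
    {l : Filter ι} [NormedAddCommGroup E] {f : ι → X → E} {Q : X → ℝ} (hQ : Integrable Q μ)
    (h : ∀ η > 0, ∀ᶠ n in l, ∀ᵐ x ∂μ, ‖f n x‖ ≤ η * ‖Q x‖) :
    Tendsto (fun n => ∫ x, ‖f n x‖ ∂μ) l (𝓝 0) := by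
  let I := ∫ x, ‖Q x‖ ∂μ
  have hI : 0 < I + 1 := by positivity
  refine Metric.tendsto_nhds.2 fun δ hδ => (h (δ / (I + 1)) (div_pos hδ hI)).mono fun n hn => ?_
  rw [dist_zero_right, Real.norm_of_nonneg (integral_nonneg fun _ => norm_nonneg _)]
  calc ∫ x, ‖f n x‖ ∂μ ≤ δ / (I + 1) * I := by
        rw [← integral_const_mul]
        exact integral_mono_of_nonneg (ae_of_all _ fun _ => norm_nonneg _) (hQ.norm.const_mul _) hn
    _ < δ := by
        rw [div_mul_eq_mul_div, div_lt_iff₀ hI]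
        linarith [mul_add δ I 1]

namespace IsWeakSolution

theorem energy_ae_eq_const (hT : 0 < T) (hb : IsWeakSolution T b j) (hpq : p⁻¹ + 2 * q⁻¹ = 1)
    (hQ : IntegrableOn Q (Ioo 0 T)) (h : IncrementLittleO p q T b j Q) :
    ∃ E, ∀ᵐ t ∂(volume.restrict (Ioo 0 T)), energy (b t) = E := by
  obtain ⟨A, ε, K, hA, hε, hK⟩ := exists_sequence_isAnnularKernel L
  suffices H : HasWeakDeriv 0 T (fun t => ∫ x, ‖b t x‖ ^ 2) 0 by
    obtain ⟨E, hE⟩ := H.ae_eq_const hT hb.integrableOn_integral_norm_sq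
    exact ⟨1 / 2 * E, hE.mono fun t ht => by rw [energy, ht]⟩
  refine .of_subintervals fun a c ha hac hc => ?_
  have hsub : Ioo a c ⊆ Ioo 0 T := Ioo_subset_Ioo ha.le hc.le
  have hflux : ∀ η > 0, ∀ᶠ n in atTop, ∀ᵐ t ∂(volume.restrict (Ioo a c)),
      ‖-2 * energyFlux (K n) (b t) (j t)‖ ≤ η * ‖Q t‖ :=
    fun _ => hb.eventually_norm_energyFlux_le ha hc hpq h hA hε hK
  have hflux_int : ∀ᶠ n in atTop,
      IntegrableOn (fun t => -2 * energyFlux (K n) (b t) (j t)) (Ioo a c) :=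
    (hflux 1 one_pos).mono fun n hn => Integrable.mono' ((hQ.mono_set hsub).norm.const_mul 1)
      (((hb.aestronglyMeasurable_energyFlux (hK n).smooth.continuous).mono_set hsub).const_mul
        (-2)) hn
  refine HasWeakDeriv.of_tendsto (l := atTop)
    (Eventually.of_forall fun n =>
      hb.hasWeakDeriv_integral_norm_sq_average ha hac hc (hK n).smooth)
    (Eventually.of_forall fun n =>
      (hb.integrableOn_integral_norm_sq_average (hK n)).mono_set hsub)
    (hb.integrableOn_integral_norm_sq.mono_set hsub) hflux_int integrableOn_zero ?_ ?_
  · have hlim := hb.tendsto_integral_norm_sq_average_sub (hε.mono_right nhdsWithin_le_nhds) hK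
    refine squeeze_zero (fun n => by positivity) (fun n => ?_) hlim
    exact setIntegral_mono_set ((hb.integrableOn_integral_norm_sq_average (hK n)).sub
      hb.integrableOn_integral_norm_sq).norm (ae_of_all _ fun t => norm_nonneg _) hsub.eventuallyLE
  · simpa only [Pi.zero_apply, sub_zero] using
      tendsto_integral_norm_of_forall_ae_le (hQ.mono_set hsub) hflux

end IsWeakSolution

end Conservation

section Mollifier

lemma bump_eq_expNegInvGlue (y : E3) : bump y = expNegInvGlue (1 - ‖y‖ ^ 2) := by
  have hiff : ‖y‖ < 1 ↔ ¬ 1 - ‖y‖ ^ 2 ≤ 0 := by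
    rw [not_le, sub_pos, sq_lt_one_iff₀ (norm_nonneg y)]
  simp only [bump, expNegInvGlue, hiff, ite_not, neg_div, one_div]

lemma contDiff_bump : ContDiff ℝ ∞ bump := by
  rw [funext bump_eq_expNegInvGlue]
  exact expNegInvGlue.contDiff.comp (contDiff_const.sub (contDiff_norm_sq ℝ))

lemma continuous_gradient_mollifier (ε : ℝ) : Continuous (gradient (mollifier ε)) :=
  have h : ContDiff ℝ ∞ (mollifier ε) :=
    contDiff_const.mul (contDiff_const.mul (contDiff_bump.comp (contDiff_id.const_smul ε⁻¹)))
  (InnerProductSpace.toDual ℝ E3).symm.continuous.comp (h.continuous_fderiv (by simp))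

lemma gradient_mollifier_eq_zero {ε : ℝ} (hε : 0 < ε) {ℓ : E3} (hℓ : ε < ‖ℓ‖) :
    gradient (mollifier ε) ℓ = 0 := by
  have h : mollifier ε =ᶠ[𝓝 ℓ] fun _ => 0 := by
    filter_upwards [(isOpen_lt continuous_const continuous_norm).mem_nhds hℓ] with y hy
    have hnorm : ¬ ‖ε⁻¹ • y‖ < 1 := by
      rw [norm_smul, norm_inv, Real.norm_of_nonneg hε.le, inv_mul_lt_iff₀ hε, mul_one]
      exact not_lt_of_gt hy
    rw [mollifier, bump, if_neg hnorm, mul_zero, mul_zero]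
  rw [gradient, h.fderiv_eq, ← gradient, gradient_fun_const]

lemma integrable_gradient_mollifier {ε : ℝ} (hε : 0 < ε) :
    Integrable (gradient (mollifier ε)) :=
  (continuous_gradient_mollifier ε).integrable_of_hasCompactSupport <|
    .intro (isCompact_closedBall 0 ε) fun ℓ hℓ =>
      gradient_mollifier_eq_zero hε (by simpa using hℓ)

lemma gradient_mollifier (ε : ℝ) (ℓ : E3) :
    gradient (mollifier ε) ℓ = ((ε ^ 3)⁻¹ * ε⁻¹) • gradient (mollifier 1) (ε⁻¹ • ℓ) := by
  have hscale : mollifier ε = (ε ^ 3)⁻¹ • fun y => mollifier 1 (ε⁻¹ • y) := by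
    ext y
    simp [mollifier]
  rw [gradient, hscale, fderiv_const_smul_field, Pi.smul_apply, fderiv_comp_smul,
    map_smul, map_smul, smul_smul, ← gradient]

lemma lintegral_enorm_gradient_mollifier {ε : ℝ} (hε : 0 < ε) :
    ∫⁻ ℓ, ‖gradient (mollifier ε) ℓ‖ₑ
      = ENNReal.ofReal (ε⁻¹ * ∫ ℓ, ‖gradient (mollifier 1) ℓ‖) := by
  rw [← ofReal_integral_norm_eq_lintegral_enorm (integrable_gradient_mollifier hε)]
  simp only [gradient_mollifier ε, norm_smul]
  rw [integral_const_mul, Measure.integral_comp_inv_smul_of_nonneg volume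
      (fun ℓ => ‖gradient (mollifier 1) ℓ‖) hε.le, finrank_euclideanSpace_fin,
    Real.norm_of_nonneg (by positivity), smul_eq_mul]
  congr 1
  field_simp

end Mollifier

section Dissipation

lemma lintegral_lintegral_mul_le_of_forall_le {X Y : Type*} [MeasurableSpace X]
    [MeasurableSpace Y] {μ : Measure X} {ν : Measure Y} [SFinite μ] [SFinite ν] {g : Y → ℝ≥0∞}
    {w : X → Y → ℝ≥0∞} (hg : AEMeasurable g ν)
    (hw : AEMeasurable (Function.uncurry w) (μ.prod ν)) {c : ℝ≥0∞}
    (h : ∀ y, g y ≠ 0 → ∫⁻ x, w x y ∂μ ≤ c) :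
    ∫⁻ x, ∫⁻ y, g y * w x y ∂ν ∂μ ≤ (∫⁻ y, g y ∂ν) * c := by
  rw [lintegral_lintegral_swap (hg.comp_snd.mul hw), ← lintegral_mul_const'' _ hg]
  refine lintegral_mono_ae ?_
  filter_upwards [hw.prod_swap.aestronglyMeasurable.prodMk_left] with y hy
  refine (lintegral_const_mul'' _ hy.aemeasurable).trans_le ?_
  obtain hg0 | hg0 := eq_or_ne (g y) 0
  · simp [hg0]
  · exact mul_le_mul_right (h y hg0) _

lemma incr_zero {L : ℝ} (f : Torus L → E3) : incr f 0 = 0 := by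
  ext1 x
  rw [incr, show proj L 0 = 0 from rfl, add_zero, sub_self, Pi.zero_apply]

lemma enorm_dissipation_le {L : ℝ} (b j : ℝ → Torus L → E3) (ε t : ℝ) (x : Torus L) :
    ‖dissipation b j ε t x‖ₑ ≤ ∫⁻ ℓ : E3, ‖gradient (mollifier ε) ℓ‖ₑ
      * (‖incr (j t) ℓ x‖ₑ * (‖incr (b t) ℓ x‖ₑ * ‖incr (b t) ℓ x‖ₑ)) := by
  set I := ∫⁻ ℓ : E3, ‖gradient (mollifier ε) ℓ‖ₑ
      * (‖incr (j t) ℓ x‖ₑ * (‖incr (b t) ℓ x‖ₑ * ‖incr (b t) ℓ x‖ₑ))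
  have hinner (u v : E3) : ‖inner ℝ u v‖ₑ ≤ ‖u‖ₑ * ‖v‖ₑ :=
    enorm_le_enorm_mul_of_norm_le (norm_inner_le_norm u v)
  have hfirst : ‖∫ ℓ : E3, inner ℝ (gradient (mollifier ε) ℓ) (incr (j t) ℓ x)
      * ‖incr (b t) ℓ x‖ ^ 2‖ₑ ≤ I := by
    refine (enorm_integral_le_lintegral_enorm _).trans (lintegral_mono fun ℓ => ?_)
    rw [enorm_mul, enorm_pow, enorm_norm, pow_two]
    exact (mul_le_mul_left (hinner _ _) _).trans_eq (mul_assoc _ _ _)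
  have hsecond : ‖∫ ℓ : E3, inner ℝ (gradient (mollifier ε) ℓ) (incr (b t) ℓ x)
      * inner ℝ (incr (j t) ℓ x) (incr (b t) ℓ x)‖ₑ ≤ I := by
    refine (enorm_integral_le_lintegral_enorm _).trans (lintegral_mono fun ℓ => ?_)
    rw [enorm_mul]
    exact (mul_le_mul' (hinner _ _) (hinner _ _)).trans_eq (by ring)
  have hcoeff : ‖(1 / 8 : ℝ)‖ₑ + ‖(1 / 4 : ℝ)‖ₑ ≤ 1 := by
    rw [Real.enorm_of_nonneg (by norm_num), Real.enorm_of_nonneg (by norm_num),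
      ← ENNReal.ofReal_add (by norm_num) (by norm_num), ENNReal.ofReal_le_one]
    norm_num
  calc ‖dissipation b j ε t x‖ₑ ≤ ‖(1 / 8 : ℝ)‖ₑ * I + ‖(1 / 4 : ℝ)‖ₑ * I := by
        refine enorm_sub_le.trans (add_le_add ?_ ?_) <;> rw [enorm_mul] <;> gcongr
    _ ≤ I := by
        rw [← add_mul]
        exact mul_le_of_le_one_left' hcoeff

variable {L : ℝ} [Fact (0 < L)] {τ : Measure ℝ} [SFinite τ] {b j : ℝ → Torus L → E3}
  {p q : ℝ≥0∞}

lemma aestronglyMeasurable_incr {f : ℝ → Torus L → E3}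
    (hf : AEStronglyMeasurable (fun w : ℝ × Torus L => f w.1 w.2) (τ.prod volume)) :
    AEStronglyMeasurable (fun w : (ℝ × Torus L) × E3 => incr (f w.1.1) w.2 w.1.2)
      ((τ.prod volume).prod volume) := by
  have hmeas : Measurable fun w : (ℝ × Torus L) × E3 => (w.1.1, w.1.2 + proj L w.2) :=
    measurable_fst.fst.prodMk
      (measurable_fst.snd.add (continuous_proj.measurable.comp measurable_snd))
  have hshift : Measure.QuasiMeasurePreserving
      (fun w : (ℝ × Torus L) × E3 => (w.1.1, w.1.2 + proj L w.2))
      ((τ.prod volume).prod volume) (τ.prod volume) :=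
    QuasiMeasurePreserving.prod_of_left hmeas <| ae_of_all _ fun ℓ =>
      ((MeasurePreserving.id τ).prod
        (measurePreserving_add_right volume (proj L ℓ))).quasiMeasurePreserving
  exact (hf.comp_quasiMeasurePreserving hshift).sub hf.comp_fst

lemma aestronglyMeasurable_dissipation
    (hb : AEStronglyMeasurable (fun w : ℝ × Torus L => b w.1 w.2) (τ.prod volume))
    (hj : AEStronglyMeasurable (fun w : ℝ × Torus L => j w.1 w.2) (τ.prod volume)) (ε : ℝ) :
    AEStronglyMeasurable (fun w : ℝ × Torus L => dissipation b j ε w.1 w.2) (τ.prod volume) := by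
  have hbℓ := aestronglyMeasurable_incr hb
  have hjℓ := aestronglyMeasurable_incr hj
  have hφ : AEStronglyMeasurable (fun w : (ℝ × Torus L) × E3 => gradient (mollifier ε) w.2)
      ((τ.prod volume).prod volume) :=
    (continuous_gradient_mollifier ε).aestronglyMeasurable.comp_snd
  exact (((hφ.inner (𝕜 := ℝ) hjℓ).mul (hbℓ.norm.pow 2)).integral_prod_right'.const_mul (1 / 8)).sub
    (((hφ.inner (𝕜 := ℝ) hbℓ).mul (hjℓ.inner (𝕜 := ℝ) hbℓ)).integral_prod_right'.const_mul (1 / 4))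

omit [SFinite τ] in
lemma lintegral_enorm_incr_mul_mul_le (hpq : p⁻¹ + 2 * q⁻¹ = 1)
    (hb : AEStronglyMeasurable (fun w : ℝ × Torus L => b w.1 w.2) (τ.prod volume))
    (hj : AEStronglyMeasurable (fun w : ℝ × Torus L => j w.1 w.2) (τ.prod volume)) {ℓ : E3}
    {B : ℝ → ℝ≥0∞}
    (hB : ∀ᵐ t ∂τ, eLpNorm (incr (j t) ℓ) p volume
      * (eLpNorm (incr (b t) ℓ) q volume * eLpNorm (incr (b t) ℓ) q volume) ≤ B t) :
    ∫⁻ w, ‖incr (j w.1) ℓ w.2‖ₑ * (‖incr (b w.1) ℓ w.2‖ₑ * ‖incr (b w.1) ℓ w.2‖ₑ) ∂(τ.prod volume)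
      ≤ ∫⁻ t, B t ∂τ := by
  refine (lintegral_prod_le _).trans (lintegral_mono_ae ?_)
  filter_upwards [hB, hb.prodMk_left, hj.prodMk_left] with t ht hbt hjt
  have hbℓ := (aestronglyMeasurable_comp_add_right hbt (proj L ℓ)).sub hbt
  have hjℓ := (aestronglyMeasurable_comp_add_right hjt (proj L ℓ)).sub hjt
  exact (lintegral_enorm_mul_mul_le_eLpNorm hpq hjℓ hbℓ hbℓ).trans ht

lemma lintegral_enorm_dissipation_le (hpq : p⁻¹ + 2 * q⁻¹ = 1)
    (hb : AEStronglyMeasurable (fun w : ℝ × Torus L => b w.1 w.2) (τ.prod volume))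
    (hj : AEStronglyMeasurable (fun w : ℝ × Torus L => j w.1 w.2) (τ.prod volume)) {ε : ℝ}
    (hε : 0 < ε) {B : ℝ → ℝ≥0∞}
    (hB : ∀ ℓ : E3, ‖ℓ‖ ∈ Ioc 0 ε → ∀ᵐ t ∂τ, eLpNorm (incr (j t) ℓ) p volume
      * (eLpNorm (incr (b t) ℓ) q volume * eLpNorm (incr (b t) ℓ) q volume) ≤ B t) :
    ∫⁻ w, ‖dissipation b j ε w.1 w.2‖ₑ ∂(τ.prod volume)
      ≤ (∫⁻ ℓ, ‖gradient (mollifier ε) ℓ‖ₑ) * ∫⁻ t, B t ∂τ := by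
  have hbℓ := (aestronglyMeasurable_incr hb).enorm
  have hjℓ := (aestronglyMeasurable_incr hj).enorm
  have hφ : AEMeasurable (fun ℓ => ‖gradient (mollifier ε) ℓ‖ₑ) volume :=
    (continuous_gradient_mollifier ε).aestronglyMeasurable.enorm
  calc ∫⁻ w, ‖dissipation b j ε w.1 w.2‖ₑ ∂(τ.prod volume)
      ≤ ∫⁻ w, (∫⁻ ℓ, ‖gradient (mollifier ε) ℓ‖ₑ * (‖incr (j w.1) ℓ w.2‖ₑ
        * (‖incr (b w.1) ℓ w.2‖ₑ * ‖incr (b w.1) ℓ w.2‖ₑ))) ∂(τ.prod volume) :=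
        lintegral_mono fun w => enorm_dissipation_le b j ε w.1 w.2
    _ ≤ (∫⁻ ℓ, ‖gradient (mollifier ε) ℓ‖ₑ) * ∫⁻ t, B t ∂τ :=
        lintegral_lintegral_mul_le_of_forall_le hφ (hjℓ.mul (hbℓ.mul hbℓ)) fun ℓ hℓ => ?_
  obtain rfl | hℓ0 := eq_or_ne ℓ 0
  · simp [incr_zero]
  have hℓε : ‖ℓ‖ ≤ ε := not_lt.1 fun h => hℓ (by rw [gradient_mollifier_eq_zero hε h, enorm_zero])
  exact lintegral_enorm_incr_mul_mul_le hpq hb hj (hB ℓ ⟨norm_pos_iff.2 hℓ0, hℓε⟩)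

variable {T : ℝ} {Q : ℝ → ℝ}

lemma IncrementLittleO.eventually_forall_ae_le (h : IncrementLittleO p q T b j Q) {η : ℝ}
    (hη : 0 < η) :
    ∀ᶠ ε in 𝓝[>] (0 : ℝ), ∀ ℓ : E3, ‖ℓ‖ ∈ Ioc 0 ε → ∀ᵐ t ∂(volume.restrict (Ioo 0 T)),
      eLpNorm (incr (j t) ℓ) p volume
        * (eLpNorm (incr (b t) ℓ) q volume * eLpNorm (incr (b t) ℓ) q volume)
        ≤ ENNReal.ofReal (ε * η * ‖Q t‖) := by
  obtain ⟨δ, hδ, hbound⟩ := mem_nhdsGT_iff_exists_Ioo_subset.1 (h η hη)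
  filter_upwards [Ioo_mem_nhdsGT hδ] with ε hε ℓ hℓ
  have hmem : ‖ℓ‖ ∈ Icc ‖ℓ‖ (4 * ‖ℓ‖) := ⟨le_rfl, by linarith [hℓ.1]⟩
  filter_upwards [hbound ⟨hℓ.1, hℓ.2.trans_lt hε.2⟩] with t ht
  refine (ht ℓ ℓ ℓ hmem hmem hmem).trans (ENNReal.ofReal_le_ofReal ?_)
  calc ‖ℓ‖ * η * Q t ≤ ‖ℓ‖ * η * ‖Q t‖ := by
        gcongr
        exact le_abs_self _
    _ ≤ ε * η * ‖Q t‖ := by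
        gcongr
        exact hℓ.2

lemma IncrementLittleO.eventually_lintegral_enorm_dissipation_le
    (h : IncrementLittleO p q T b j Q) (hpq : p⁻¹ + 2 * q⁻¹ = 1)
    (hQ : IntegrableOn Q (Ioo 0 T))
    (hb : AEStronglyMeasurable (fun w : ℝ × Torus L => b w.1 w.2) (spaceTime L T))
    (hj : AEStronglyMeasurable (fun w : ℝ × Torus L => j w.1 w.2) (spaceTime L T)) {η : ℝ}
    (hη : 0 < η) :
    ∀ᶠ ε in 𝓝[>] (0 : ℝ), ∫⁻ w, ‖dissipation b j ε w.1 w.2‖ₑ ∂(spaceTime L T)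
      ≤ ENNReal.ofReal
        (η * ((∫ ℓ, ‖gradient (mollifier 1) ℓ‖) * ∫ t in Ioo 0 T, ‖Q t‖)) := by
  filter_upwards [h.eventually_forall_ae_le hη, self_mem_nhdsWithin] with ε hε hε0
  have hε0 : 0 < ε := hε0
  refine (lintegral_enorm_dissipation_le hpq hb hj hε0 hε).trans_eq ?_
  rw [lintegral_enorm_gradient_mollifier hε0, ← ofReal_integral_eq_lintegral_ofReal
      (hQ.norm.const_mul _) (ae_of_all _ fun t => by positivity), integral_const_mul,
    ← ENNReal.ofReal_mul (by positivity)]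
  congr 1
  field_simp

theorem IsWeakSolution.dissipation_vanishes (hb : IsWeakSolution T b j)
    (hpq : p⁻¹ + 2 * q⁻¹ = 1) (hQ : IntegrableOn Q (Ioo 0 T)) (h : IncrementLittleO p q T b j Q) :
    (∀ᶠ ε in 𝓝[>] (0 : ℝ), Integrable
        (fun w : ℝ × Torus L => dissipation b j ε w.1 w.2) (spaceTime L T)) ∧
      Tendsto (fun ε : ℝ => ∫⁻ w, ‖dissipation b j ε w.1 w.2‖ₑ ∂(spaceTime L T))
        (𝓝[>] 0) (𝓝 0) := by
  have hbound {η : ℝ} (hη : 0 < η) := h.eventually_lintegral_enorm_dissipation_le hpq hQ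
    hb.measurable_b hb.measurable_j hη
  constructor
  · filter_upwards [hbound one_pos] with ε hε
    exact ⟨aestronglyMeasurable_dissipation hb.measurable_b hb.measurable_j ε,
      hε.trans_lt ENNReal.ofReal_lt_top⟩
  · set c := (∫ ℓ, ‖gradient (mollifier 1) ℓ‖) * ∫ t in Ioo 0 T, ‖Q t‖
    have hlim : Tendsto (fun η : ℝ => ENNReal.ofReal (η * c)) (𝓝[>] 0) (𝓝 0) := by
      have hmul : Tendsto (fun η : ℝ => η * c) (𝓝 0) (𝓝 0) :=
        (continuous_mul_const c).tendsto' 0 0 (zero_mul c)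
      simpa using (ENNReal.tendsto_ofReal hmul).mono_left nhdsWithin_le_nhds
    refine ENNReal.tendsto_nhds_zero.2 fun γ hγ => ?_
    obtain ⟨η, hη, hη0⟩ :=
      ((ENNReal.tendsto_nhds_zero.1 hlim γ hγ).and self_mem_nhdsWithin).exists
    exact (hbound hη0).mono fun ε hε => hε.trans hη

end Dissipation

lemma inv_nine_fifths_add_two_mul_inv_nine_halves :
    (9 / 5 : ℝ≥0∞)⁻¹ + 2 * (9 / 2 : ℝ≥0∞)⁻¹ = 1 := by
  rw [ENNReal.inv_div (by simp) (by simp), ENNReal.inv_div (by simp) (by simp), ← mul_div_assoc,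
    ENNReal.div_add_div_same]
  norm_num
  exact ENNReal.div_self (by simp) (by simp)

end EMHD

end

open EMHD ENNReal in
theorem corollary1p6_general {L T : ℝ} [Fact (0 < L)] (hT : 0 < T) {b j : ℝ → Torus L → E3}
    (hb : IsWeakSolution T b j) {p q : ℝ≥0∞} (hpq : p⁻¹ + 2 * q⁻¹ = 1) {r₁ r₂ α β s : ℝ}
    (hr₁ : 0 < r₁) (hr₂ : 0 < r₂) (hr : 2 / r₁ + 1 / r₂ = 1) (hαβ : 1 ≤ 2 * α + β) (hs : 0 < s)
    {C₁ C₂ : ℝ → ℝ} (hC₁ : IntegrableOn C₁ (Ioo 0 T)) (hC₂ : IntegrableOn C₂ (Ioo 0 T))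
    (hC₁_nonneg : ∀ t ∈ Ioo 0 T, 0 ≤ C₁ t) (hC₂_nonneg : ∀ t ∈ Ioo 0 T, 0 ≤ C₂ t)
    {σ₁ σ₂ : E3 → ℝ} {ρ K : ℝ} (hρ : 0 < ρ)
    (hσ₁ : ∀ ℓ, ‖ℓ‖ < ρ → 0 ≤ σ₁ ℓ ∧ σ₁ ℓ ≤ K) (hσ₂ : ∀ ℓ, ‖ℓ‖ < ρ → 0 ≤ σ₂ ℓ ∧ σ₂ ℓ ≤ K)
    (hσ : Tendsto σ₁ (𝓝[≠] 0) (𝓝 0) ∨ Tendsto σ₂ (𝓝[≠] 0) (𝓝 0))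
    (hb_incr : ∀ᵐ t ∂(volume.restrict (Ioo 0 T)), ∀ ℓ : E3, ‖ℓ‖ < ρ →
      eLpNorm (incr (b t) ℓ) q volume ≤ ENNReal.ofReal (C₁ t ^ (1 / r₁) * ‖ℓ‖ ^ α * σ₁ ℓ ^ s))
    (hj_incr : ∀ᵐ t ∂(volume.restrict (Ioo 0 T)), ∀ ℓ : E3, ‖ℓ‖ < ρ →
      eLpNorm (incr (j t) ℓ) p volume ≤ ENNReal.ofReal (C₂ t ^ (1 / r₂) * ‖ℓ‖ ^ β * σ₂ ℓ ^ s)) :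
    ((∀ᶠ ε in 𝓝[>] (0 : ℝ), Integrable
        (fun w : ℝ × Torus L => dissipation b j ε w.1 w.2) (spaceTime L T)) ∧
      Tendsto (fun ε : ℝ => ∫⁻ w, ‖dissipation b j ε w.1 w.2‖ₑ ∂(spaceTime L T))
        (𝓝[>] 0) (𝓝 0)) ∧
    ∃ E : ℝ, ∀ᵐ t ∂(volume.restrict (Ioo 0 T)), energy (b t) = E := by
  have hQ := (hC₁.const_mul (2 / r₁)).add (hC₂.const_mul (1 / r₂))
  have h := incrementLittleO_of_modulus hr₁ hr₂ hr hαβ hC₁_nonneg hC₂_nonneg hρ hs hσ₁ hσ₂ hσ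
    hb_incr hj_incr
  exact ⟨hb.dissipation_vanishes hpq hQ h, hb.energy_ae_eq_const hT hpq hQ h⟩

theorem corollary1p6 (L T : ℝ) [Fact (0 < L)] (hT : 0 < T)
    (b j : ℝ → EMHD.Torus L → EMHD.E3) (hb : EMHD.IsWeakSolution T b j)
    (r₁ r₂ α β : ℝ) (hr₁ : 1 < r₁) (hr₂ : 1 < r₂) (hr : 2 / r₁ + 1 / r₂ = 1)
    (hαβ : 1 ≤ 2 * α + β)
    (C₁ C₂ : ℝ → ℝ)
    (hC₁ : IntegrableOn C₁ (Ioo 0 T)) (hC₂ : IntegrableOn C₂ (Ioo 0 T))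
    (hC₁_nonneg : ∀ t ∈ Ioo 0 T, 0 ≤ C₁ t) (hC₂_nonneg : ∀ t ∈ Ioo 0 T, 0 ≤ C₂ t)
    (σ₁ σ₂ : EMHD.E3 → ℝ) (ρ K : ℝ) (hρ : 0 < ρ)
    (hσ₁ : ∀ ℓ, ‖ℓ‖ < ρ → 0 ≤ σ₁ ℓ ∧ σ₁ ℓ ≤ K)
    (hσ₂ : ∀ ℓ, ‖ℓ‖ < ρ → 0 ≤ σ₂ ℓ ∧ σ₂ ℓ ≤ K)
    (hσ : Tendsto σ₁ (𝓝[≠] 0) (𝓝 0) ∨ Tendsto σ₂ (𝓝[≠] 0) (𝓝 0))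
    (hb_incr : ∀ᵐ t ∂(volume.restrict (Ioo 0 T)), ∀ ℓ : EMHD.E3, ‖ℓ‖ < ρ →
      eLpNorm (EMHD.incr (b t) ℓ) (9 / 2) volume
        ≤ ENNReal.ofReal (C₁ t ^ (1 / r₁) * ‖ℓ‖ ^ α * σ₁ ℓ ^ (1 / 3 : ℝ)))
    (hj_incr : ∀ᵐ t ∂(volume.restrict (Ioo 0 T)), ∀ ℓ : EMHD.E3, ‖ℓ‖ < ρ →
      eLpNorm (EMHD.incr (j t) ℓ) (9 / 5) volume
        ≤ ENNReal.ofReal (C₂ t ^ (1 / r₂) * ‖ℓ‖ ^ β * σ₂ ℓ ^ (1 / 3 : ℝ))) :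
    -- the dissipation term vanishes: `D(b,j;ε) → 0` in `L¹((0,T) × 𝕋³)`
    ((∀ᶠ ε in 𝓝[>] (0 : ℝ), Integrable
        (fun p : ℝ × EMHD.Torus L => EMHD.dissipation b j ε p.1 p.2) (EMHD.spaceTime L T)) ∧
      Tendsto (fun ε : ℝ => ∫⁻ p, ‖EMHD.dissipation b j ε p.1 p.2‖ₑ ∂(EMHD.spaceTime L T))
        (𝓝[>] 0) (𝓝 0)) ∧
    -- the energy is conserved
    ∃ E : ℝ, ∀ᵐ t ∂(volume.restrict (Ioo 0 T)), EMHD.energy (b t) = E :=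
  corollary1p6_general hT hb EMHD.inv_nine_fifths_add_two_mul_inv_nine_halves
    (one_pos.trans hr₁) (one_pos.trans hr₂) hr hαβ (by norm_num) hC₁ hC₂ hC₁_nonneg hC₂_nonneg
    hρ hσ₁ hσ₂ hσ hb_incr hj_incr
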